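/- **Model.** Let $L, J\ge 0$ and $\mathsf K\ge 1$ be integers, $0<\rho\le 1$, $N_0,W>0$, received powers $P_j>0$ ($1\le j\le J$), tolerable error probabilities $0<P_{e,l}<1$ and message alphabet sizes $M_l\ge 1$ ($1\le l\le L$), and put $S_l=-\ln P_{e,l}+\rho\ln M_l$. A schedule is a vector $s=(s_{lj})$ of nonnegative integers with $\sum_{l,j}s_{lj}\le\mathsf K$; $\mathcal S_{\mathsf K}$ is the set of schedules. For $s\in\mathcal S_{\mathsf K}$ let $$\phi_j(s)=\rho\ln\Big(1+\frac{P_j}{(1+\rho)\big(N_0W+\sum_{l',j'}s_{l'j'}P_{j'}-P_j\big)}\Big)\ \text{ if } \sum_l s_{lj}>0,\qquad \phi_j(s)=0\ \text{ otherwise.}$$ In each slot, $A_{lj}$ messages of class $(l,j)$ arrive; the $A_{lj}$ are independent over the classes and i.i.d. over the slots, with $\mathbb E A_{lj}^2<\infty$. A state-independent policy is a probability measure $p$ on $\mathcal S_{\mathsf K}$, implemented together with probability measures $q_{lj}$ on $\{s\in\mathcal S_{\mathsf K}:s_{lj}>0\}$ as follows. Each arriving message of class $(l,j)$ gets, independently,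 a schedule $z$ with law $q_{lj}$ and the residual requirement $x=S_l$. In each slot a schedule $s$ is drawn with law $p$, independently of the state. For each $(l,j)$, $t_{lj}=\min(s_{lj},n_{ljs})$ of the $n_{ljs}$ messages of class $(l,j)$ with assigned schedule $s$ are transmitted (chosen by an arbitrary fixed rule depending on the state and $s$), the residual requirement of each transmitted message of class $(l,j)$ decreases by $\phi_j(t)$, and the message leaves once its requirement is met. Then the arrivals of the slot join. This defines a Markov chain on the countable set $\mathcal X$ of finite sequences of messages $(x,l,j,z)$ with $z_{lj}>0$ and $x$ a possible residual requirement, i.e. $x>0$ is $S_l$ minus a finite sum of quanta $\phi_j(t)$ with $t\in\mathcal S_{\mathsf K}$, $t\le z$. **Region.** For $x,y>0$ let $\lceil x\rceil_y=\min\{n\ge1:x\le ny\}\,y$. Let $$\psi_{lj}(p)=\sum_{s\in\mathcal S_{\mathsf K}:\,s_{lj}>0}p(s)\frac{s_{lj}\phi_j(s)}{\lceil S_l\rceil_{\phi_j(s)}},\qquad \mathcal R_{in}(\Omega^{\mathsf K})=\bigcup_p\{\beta\in\mathbb R_+^{LJ}:\beta_{lj}\le\psi_{lj}(p)\text{ for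 all } l,j\},$$ the union being over all probability measures $p$ on $\mathcal S_{\mathsf K}$. **Statement.** Suppose that $\mathbb EA=(\mathbb EA_{lj})$ lies in the interior of $\mathcal R_{in}(\Omega^{\mathsf K})$ relative to $\mathbb R_+^{LJ}$ (equivalently, $\mathbb EA_{lj}<\psi_{lj}(p)$ for all $l,j$, for some $p$). Then there are a state-independent policy $p$ and classification measures $q_{lj}$ such that, for every rule choosing the transmitted messages, the Markov chain is positive recurrent (from every state, the expected time to enter the set of positive recurrent states is finite; if the chain is irreducible, this says that all states are positive recurrent), it has a stationary distribution, and under every stationary distribution the mean number of messages of each class is finite. -/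

import Mathlib

open scoped ENNReal Topology

noncomputable section

namespace Multiaccess

/-! ### General countable Markov chains given by their transition law -/

section Chain

variable {σ : Type*}

open Classical in
/-- `survive κ C n x` is the probability that the chain with transition law `κ`, started at `x`,
is outside `C` at all the times `1, …, n`, that is, `P_x (τ_C > n)` for the return time
`τ_C = inf {n ≥ 1 | X_n ∈ C}`. -/
def survive (κ : σ → PMF σ) (C : Set σ) : ℕ → σ → ℝ≥0∞
  | 0, _ => 1
  | n + 1, x => ∑' y, κ x y * (if y ∈ C then 0 else survive κ C n y)

/-- The expected return time `E_x τ_C = ∑_{n ≥ 0} P_x (τ_C > n)`. -/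
def meanReturnTime (κ : σ → PMF σ) (C : Set σ) (x : σ) : ℝ≥0∞ :=
  ∑' n, survive κ C n x

/-- The state `x` is positive recurrent: its expected return time to itself is finite. -/
def PositiveRecurrentState (κ : σ → PMF σ) (x : σ) : Prop :=
  meanReturnTime κ {x} x < ⊤

/-- The chain is positive recurrent: from every state, the set of positive recurrent states is
entered within a finite expected time. For an irreducible chain this says that all states are
positive recurrent. -/
def PositiveRecurrent (κ : σ → PMF σ) : Prop :=
  ∀ x, meanReturnTime κ {y | PositiveRecurrentState κ y} x < ⊤

/-- `π` is a stationary distribution of the chain. -/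
def IsStationary (κ : σ → PMF σ) (π : PMF σ) : Prop :=
  π.bind κ = π

end Chain

/-- The law of a list of `n` independent samples of `q`. -/
def iidList {β : Type*} (q : PMF β) : ℕ → PMF (List β)
  | 0 => PMF.pure []
  | n + 1 => q.bind fun b => (iidList q n).map (b :: ·)

/-- The law of the concatenation of independent random lists with the given laws. -/
def concatLaw {β : Type*} : List (PMF (List β)) → PMF (List β)
  | [] => PMF.pure []
  | d :: ds => d.bind fun a => (concatLaw ds).map (a ++ ·)

/-! ### The communication system -/

/-- The parameters: at most `K` simultaneous transmissions, random coding parameter `ρ`, noise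
density `N0`, bandwidth `W`, `L` service requirement classes with tolerable error probability
`Pe l` and message alphabet size `M l`, and `J` received power classes with power `P j`. -/
structure System (L J : ℕ) where
  K : ℕ
  ρ : ℝ
  N0 : ℝ
  W : ℝ
  Pe : Fin L → ℝ
  M : Fin L → ℕ
  P : Fin J → ℝ
  one_le_K : 1 ≤ K
  ρ_pos : 0 < ρ
  ρ_le_one : ρ ≤ 1
  N0_pos : 0 < N0
  W_pos : 0 < W
  Pe_pos : ∀ l, 0 < Pe l
  Pe_lt_one : ∀ l, Pe l < 1
  one_le_M : ∀ l, 1 ≤ M l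
  P_pos : ∀ j, 0 < P j

/-- `E₀(ρ, P, σ²)`. -/
def E0 (ρ P σ2 : ℝ) : ℝ :=
  ρ * Real.log (1 + P / ((1 + ρ) * σ2))

/-- `⌈x⌉_q = min {n ≥ 1 | x ≤ n q} q`. -/
def ceilMul (x q : ℝ) : ℝ :=
  (sInf {n : ℕ | 1 ≤ n ∧ x ≤ n * q} : ℕ) * q

namespace System

variable {L J : ℕ} (sys : System L J)

/-- The service requirement of the messages of class `(l, j)`. -/
def S (l : Fin L) : ℝ :=
  -Real.log (sys.Pe l) + sys.ρ * Real.log (sys.M l)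

/-- The schedules: vectors of nonnegative integers with sum at most `K`. -/
abbrev Schedule : Type :=
  {s : Fin L → Fin J → ℕ // ∑ l, ∑ j, s l j ≤ sys.K}

instance : Finite sys.Schedule := by
  have hle : ∀ (s : sys.Schedule) (l : Fin L) (j : Fin J), s.1 l j < sys.K + 1 := by
    intro s l j
    have h1 : s.1 l j ≤ ∑ j', s.1 l j' :=
      Finset.single_le_sum (f := fun j' => s.1 l j') (fun _ _ => Nat.zero_le _)
        (Finset.mem_univ j)
    have h2 : ∑ j', s.1 l j' ≤ ∑ l', ∑ j', s.1 l' j' :=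
      Finset.single_le_sum (f := fun l' => ∑ j', s.1 l' j') (fun _ _ => Nat.zero_le _)
        (Finset.mem_univ l)
    have h3 := s.2
    omega
  refine Finite.of_injective
    (fun (s : sys.Schedule) (l : Fin L) (j : Fin J) => (⟨s.1 l j, hle s l j⟩ : Fin (sys.K + 1)))
    ?_
  intro s t h
  apply Subtype.ext
  funext l j
  exact congrArg Fin.val (congrFun (congrFun h l) j)

instance : Fintype sys.Schedule := Fintype.ofFinite _

/-- The service quantum `φ_j(t)` that each message of received power class `j` obtains in a slot
in which exactly `t l' j'` messages of each class `(l', j')` are transmitted; the other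
transmissions act as noise. It is `0` if `t` transmits no message of power class `j`. -/
def quantum (j : Fin J) (t : sys.Schedule) : ℝ :=
  if 0 < ∑ l, t.1 l j then
    E0 sys.ρ (sys.P j) (sys.N0 * sys.W + ((∑ l', ∑ j', (t.1 l' j' : ℝ) * sys.P j') - sys.P j))
  else 0

/-- The possible (positive) residual service requirements of a message of subclass `(l, j, z)`:
the initial requirement, diminished by the quanta of slots in which the schedule `z` was
implemented completely or partially (in which case the transmission vector is some `t ≤ z`). -/
inductive Residual (l : Fin L) (j : Fin J) (z : sys.Schedule) : ℝ → Prop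
  | fresh : Residual l j z (sys.S l)
  | served {x : ℝ} (t : sys.Schedule) (ht : t ≤ z) (hx : Residual l j z x)
      (hpos : 0 < x - sys.quantum j t) : Residual l j z (x - sys.quantum j t)

/-- A message in the system: class `(l, j)`, assigned schedule `z`, residual requirement `x`. -/
structure Message where
  l : Fin L
  j : Fin J
  z : sys.Schedule
  z_pos : 0 < z.1 l j
  x : ℝ
  residual : sys.Residual l j z x

/-- The states: finite sequences of messages. -/
abbrev State : Type := List sys.Message

/-- The number of class `(l, j)` messages in a state. -/
def numClass (α : sys.State) (l : Fin L) (j : Fin J) : ℕ :=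
  α.countP fun m => decide (m.l = l ∧ m.j = j)

/-- The number of subclass `(l, j, s)` messages in a state. -/
def numSubclass (α : sys.State) (l : Fin L) (j : Fin J) (s : sys.Schedule) : ℕ :=
  α.countP fun m => decide (m.l = l ∧ m.j = j ∧ m.z = s)

/-- The vector of transmissions that take place when the schedule `s` is chosen in state `α`:
as many messages of subclass `(l, j, s)` as `s` asks for, or all of them if there are fewer. -/
def transmitted (α : sys.State) (s : sys.Schedule) : sys.Schedule :=
  ⟨fun l j => min (s.1 l j) (sys.numSubclass α l j s),
    (Finset.sum_le_sum fun _ _ => Finset.sum_le_sum fun _ _ => min_le_left _ _).trans s.2⟩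

theorem transmitted_le (α : sys.State) (s : sys.Schedule) : sys.transmitted α s ≤ s :=
  fun _ _ => min_le_left _ _

/-- A rule that determines, in each state `α` and for each chosen schedule `s`, which messages
(positions in `α`) are transmitted: `min (s l j) (n_{ljs}(α))` messages of each subclass
`(l, j, s)`, and no others. -/
structure SelectionRule where
  sel : (α : sys.State) → sys.Schedule → Finset (Fin α.length)
  sel_schedule : ∀ α s, ∀ i ∈ sel α s, (α.get i).z = s
  sel_card : ∀ α s l j,
    ((sel α s).filter fun i => (α.get i).l = l ∧ (α.get i).j = j).card =
      (sys.transmitted α s).1 l j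

/-- Selection rules exist. -/
instance : Nonempty sys.SelectionRule := by
  classical
  let F : (α : sys.State) → sys.Schedule → Fin L → Fin J → Finset (Fin α.length) :=
    fun α s l j => Finset.univ.filter fun i =>
      (α.get i).l = l ∧ (α.get i).j = j ∧ (α.get i).z = s
  have hF : ∀ α s l j, (F α s l j).card = sys.numSubclass α l j s := by
    intro α s l j
    have h := List.countP_map (p := fun m : sys.Message => decide (m.l = l ∧ m.j = j ∧ m.z = s))
      (f := α.get) (l := List.finRange α.length)
    have h0 : (List.finRange α.length).map α.get = α := List.map_get_finRange α
    rw [h0] at h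
    rw [numSubclass, h, List.countP_eq_length_filter]
    rw [← List.toFinset_card_of_nodup ((List.nodup_finRange _).filter _)]
    congr 1
    ext i
    simp [F]
  have hex : ∀ α s l j, ∃ T ⊆ F α s l j, T.card = (sys.transmitted α s).1 l j := by
    intro α s l j
    exact Finset.exists_subset_card_eq ((min_le_right _ _).trans (hF α s l j).ge)
  choose T hTs hTc using hex
  refine ⟨⟨fun α s => Finset.univ.biUnion fun l => Finset.univ.biUnion fun j => T α s l j,
    ?_, ?_⟩⟩
  · intro α s i hi
    simp only [Finset.mem_biUnion, Finset.mem_univ, true_and] at hi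
    obtain ⟨l, j, hi⟩ := hi
    exact ((Finset.mem_filter.1 (hTs α s l j hi)).2).2.2
  · intro α s l j
    rw [← hTc]
    congr 1
    ext i
    simp only [Finset.mem_filter, Finset.mem_biUnion, Finset.mem_univ, true_and]
    constructor
    · rintro ⟨⟨l', j', hi⟩, rfl, rfl⟩
      have h := (Finset.mem_filter.1 (hTs α s l' j' hi)).2
      obtain ⟨h1, h2, -⟩ := h
      subst h1 h2
      exact hi
    · intro hi
      have h := (Finset.mem_filter.1 (hTs α s l j hi)).2
      exact ⟨⟨l, j, hi⟩, h.1, h.2.1⟩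

/-- A message is given the quantum of the transmission vector `t`; it leaves the system
(`none`) if its residual requirement is then met. -/
def serveMessage (t : sys.Schedule) (m : sys.Message) (ht : t ≤ m.z) : Option sys.Message :=
  if h : 0 < m.x - sys.quantum m.j t then
    some ⟨m.l, m.j, m.z, m.z_pos, m.x - sys.quantum m.j t, m.residual.served t ht h⟩
  else none

/-- The messages that remain after a slot in which the schedule `s` was chosen in state `α`. -/
def serve (r : sys.SelectionRule) (α : sys.State) (s : sys.Schedule) : sys.State :=
  (List.finRange α.length).filterMap fun i =>
    if h : i ∈ r.sel α s then
      sys.serveMessage (sys.transmitted α s) (α.get i)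
        ((sys.transmitted_le α s).trans (r.sel_schedule α s i h).ge)
    else some (α.get i)

/-- The random classification of arriving messages: for each class `(l, j)`, a probability
measure on the schedules `s` with `s l j > 0`. -/
abbrev Classification : Type :=
  (l : Fin L) → (j : Fin J) → PMF {s : sys.Schedule // 0 < s.1 l j}

/-- A new message of class `(l, j)` with assigned schedule `z`. -/
def newMessage (l : Fin L) (j : Fin J) (z : {s : sys.Schedule // 0 < s.1 l j}) : sys.Message :=
  ⟨l, j, z.1, z.2, sys.S l, Residual.fresh⟩

/-- The law of the messages that arrive in a slot. The numbers `A_{lj}` of arrivals of the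
different classes are independent with laws `a l j`, and each message independently receives a
schedule with law `q l j`. -/
def arrivalLaw (a : Fin L → Fin J → PMF ℕ) (q : sys.Classification) : PMF sys.State :=
  concatLaw ((List.finRange L).flatMap fun l => (List.finRange J).map fun j =>
    (a l j).bind fun k => (iidList (q l j) k).map (List.map (sys.newMessage l j)))

/-- The transition law of the Markov chain: in each slot a schedule is chosen with law `p`
independently of the state and implemented as far as possible, and then the arrivals join. -/
def chain (a : Fin L → Fin J → PMF ℕ) (p : PMF sys.Schedule) (q : sys.Classification)
    (r : sys.SelectionRule) (α : sys.State) : PMF sys.State :=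
  p.bind fun s => (sys.arrivalLaw a q).map fun b => sys.serve r α s ++ b

/-- `ψ_{lj}` for the policy `p`. -/
def psi (p : PMF sys.Schedule) (l : Fin L) (j : Fin J) : ℝ :=
  ∑ s with 0 < s.1 l j,
    (p s).toReal * ((s.1 l j : ℝ) * sys.quantum j s / ceilMul (sys.S l) (sys.quantum j s))

/-- The region `R_in(Ω^K)`. -/
def Rin : Set (Fin L → Fin J → ℝ) :=
  ⋃ p : PMF sys.Schedule, {β | ∀ l j, 0 ≤ β l j ∧ β l j ≤ sys.psi p l j}

end System

/-- The mean arrival vector `E A`. -/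
def meanArrivals {L J : ℕ} (a : Fin L → Fin J → PMF ℕ) (l : Fin L) (j : Fin J) : ℝ :=
  ∑' k : ℕ, (k : ℝ) * (a l j k).toReal

end Multiaccess

end

/-! Since the mean arrival vector is interior to the region, some `p` satisfies E A_lj < ψ_lj(p) for
all classes, and mixing in a little of the uniform law gives `p` full support (`exists_policy`).
Write N_lj(z) = ⌈S_l / φ_j(z)⌉ (`services`). With q_lj(z) proportional to p(z) z_lj / N_lj(z), every
subclass (l, j, z) receives work, counted in complete slots, at a rate below the service p(z) z_lj
offered to it (`exists_classification`). Full support makes this strict for every subclass,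
including those that are populated only by the initial state.

The workload V of a subclass counts the slots with complete schedule z that its messages still need.
Partial transmission only lowers interference, so each transmission reduces V by at least one
(`workload_serve`). Service falls short of z_lj only when fewer than z_lj messages are present, and
then V is bounded. Hence V² has drift at most a constant minus a positive multiple of V
(`workload_drift`), and a weighted sum of the V² is a Lyapunov function whose drift dominates the
number of messages.

There are finitely many possible messages, so bounded length leaves finitely many states. Foster's
criterion, the removal of states that are not positive recurrent, the cycle formula and a truncation
argument then give the three conclusions (`stable_of_drift`). -/

open scoped ENNReal Topology

noncomputable section

namespace Multiaccess

/-! ### Expectations of nonnegative functions under a probability mass function -/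

section Expect

variable {β γ : Type*}

/-- The expectation of a nonnegative function. -/
def expect (p : PMF β) (f : β → ℝ≥0∞) : ℝ≥0∞ := ∑' b, p b * f b

theorem expect_mono (p : PMF β) {f g : β → ℝ≥0∞} (h : ∀ b, f b ≤ g b) :
    expect p f ≤ expect p g :=
  ENNReal.tsum_le_tsum fun b => by gcongr; exact h b

theorem expect_mono_support (p : PMF β) {f g : β → ℝ≥0∞} (h : ∀ b ∈ p.support, f b ≤ g b) :
    expect p f ≤ expect p g := by
  refine ENNReal.tsum_le_tsum fun b => ?_
  by_cases hb : b ∈ p.support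
  · gcongr; exact h b hb
  · simp [(PMF.apply_eq_zero_iff p b).2 hb]

theorem expect_add (p : PMF β) (f g : β → ℝ≥0∞) :
    expect p (fun b => f b + g b) = expect p f + expect p g := by
  simp only [expect, mul_add, ENNReal.tsum_add]

theorem expect_const (p : PMF β) (c : ℝ≥0∞) : expect p (fun _ => c) = c := by
  simp only [expect, ENNReal.tsum_mul_right, p.tsum_coe, one_mul]

theorem expect_const_mul (p : PMF β) (c : ℝ≥0∞) (f : β → ℝ≥0∞) :
    expect p (fun b => c * f b) = c * expect p f := by
  simp only [expect, mul_left_comm, ENNReal.tsum_mul_left]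

theorem expect_mul_const (p : PMF β) (c : ℝ≥0∞) (f : β → ℝ≥0∞) :
    expect p (fun b => f b * c) = expect p f * c := by
  simp only [expect, ← mul_assoc, ENNReal.tsum_mul_right]

theorem expect_finset_sum {ι : Type*} (s : Finset ι) (p : PMF β) (f : ι → β → ℝ≥0∞) :
    expect p (fun b => ∑ i ∈ s, f i b) = ∑ i ∈ s, expect p (f i) := by
  simp only [expect, Finset.mul_sum]
  exact Summable.tsum_finsetSum fun _ _ => ENNReal.summable

theorem expect_pure (b : β) (f : β → ℝ≥0∞) : expect (PMF.pure b) f = f b := by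
  classical
  rw [expect, tsum_eq_single b]
  · simp
  · intro b' hb'
    simp [PMF.pure_apply, hb']

theorem expect_bind (p : PMF β) (q : β → PMF γ) (f : γ → ℝ≥0∞) :
    expect (p.bind q) f = expect p fun b => expect (q b) f := by
  simp only [expect, PMF.bind_apply, ← ENNReal.tsum_mul_right, ← ENNReal.tsum_mul_left]
  rw [ENNReal.tsum_comm]
  simp only [mul_assoc]

theorem expect_map (p : PMF β) (h : β → γ) (f : γ → ℝ≥0∞) :
    expect (p.map h) f = expect p fun b => f (h b) := by
  rw [← PMF.bind_pure_comp, expect_bind]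
  simp only [Function.comp, expect_pure]

end Expect

/-! ### Foster–Lyapunov theory for countable chains -/

section Chain

variable {σ : Type*} (κ : σ → PMF σ)

open Classical in
theorem survive_succ (C : Set σ) (n : ℕ) (x : σ) :
    survive κ C (n + 1) x = expect (κ x) fun y => if y ∈ C then 0 else survive κ C n y := rfl

theorem survive_le_one (C : Set σ) (n : ℕ) (x : σ) : survive κ C n x ≤ 1 := by
  classical
  induction n generalizing x with
  | zero => exact le_rfl
  | succ n ih =>
    rw [survive_succ]
    refine (expect_mono _ fun y => ?_).trans (expect_const (κ x) 1).le
    split_ifs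
    · exact zero_le
    · exact ih y

/-- The truncated mean return time `∑_{k < n} P_x (τ_C > k)`. -/
def truncReturnTime (C : Set σ) (n : ℕ) (x : σ) : ℝ≥0∞ :=
  ∑ k ∈ Finset.range n, survive κ C k x

open Classical in
theorem truncReturnTime_succ (C : Set σ) (n : ℕ) (x : σ) :
    truncReturnTime κ C (n + 1) x
      = 1 + expect (κ x) fun y => if y ∈ C then 0 else truncReturnTime κ C n y := by
  rw [truncReturnTime, Finset.sum_range_succ', add_comm]
  congr 1
  simp only [survive_succ]
  rw [← expect_finset_sum]
  congr 1
  funext y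
  split_ifs
  · simp
  · rfl

theorem truncReturnTime_mono_nat (C : Set σ) (x : σ) :
    Monotone fun n => truncReturnTime κ C n x := fun _ _ h =>
  Finset.sum_le_sum_of_subset (Finset.range_mono h)

theorem truncReturnTime_le_meanReturnTime (C : Set σ) (n : ℕ) (x : σ) :
    truncReturnTime κ C n x ≤ meanReturnTime κ C x :=
  ENNReal.sum_le_tsum _

/-- Finiteness is what the truncation buys: terms can be cancelled in `ℝ≥0∞` before n tends to
infinity. -/
theorem truncReturnTime_ne_top (C : Set σ) (n : ℕ) (x : σ) : truncReturnTime κ C n x ≠ ⊤ :=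
  (ENNReal.sum_lt_top.2 fun _ _ => (survive_le_one κ C _ x).trans_lt ENNReal.one_lt_top).ne

theorem meanReturnTime_le {C : Set σ} {x : σ} {b : ℝ≥0∞}
    (h : ∀ n, truncReturnTime κ C n x ≤ b) : meanReturnTime κ C x ≤ b := by
  rw [meanReturnTime, ENNReal.tsum_eq_iSup_nat]
  exact iSup_le h

theorem survive_anti {C D : Set σ} (h : C ⊆ D) (n : ℕ) (x : σ) :
    survive κ D n x ≤ survive κ C n x := by
  classical
  induction n generalizing x with
  | zero => exact le_rfl
  | succ n ih =>
    simp only [survive_succ]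
    refine expect_mono _ fun y => ?_
    by_cases hC : y ∈ C
    · simp [hC, h hC]
    · by_cases hD : y ∈ D
      · simp [hD]
      · simpa [hC, hD] using ih y

theorem meanReturnTime_anti {C D : Set σ} (h : C ⊆ D) (x : σ) :
    meanReturnTime κ D x ≤ meanReturnTime κ C x :=
  ENNReal.tsum_le_tsum fun n => survive_anti κ h n x

/-- **Foster's criterion**: a Lyapunov function bounds the mean return time. -/
theorem meanReturnTime_le_of_drift {f g : σ → ℝ≥0∞} {B : ℝ≥0∞} (hB : B ≠ ⊤)
    (hd : ∀ x, expect (κ x) f + g x ≤ f x + B) (x : σ) :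
    meanReturnTime κ {y | g y ≤ B + 1} x ≤ 1 + (f x + B) := by
  classical
  obtain ⟨C, hCdef⟩ : ∃ C : Set σ, C = {y | g y ≤ B + 1} := ⟨_, rfl⟩
  rw [← hCdef]
  -- Outside `C` the drift lowers `f` by at least one per step, so `f` itself bounds the time.
  have key : ∀ n x, x ∉ C →
      truncReturnTime κ C n x ≤ f x := by
    intro n
    induction n with
    | zero => intro x _; simp [truncReturnTime]
    | succ n ih =>
      intro x hx
      have hx' : B + 1 ≤ g x := by
        rw [hCdef] at hx
        exact le_of_lt (not_le.1 hx)
      rw [truncReturnTime_succ]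
      have h1 : expect (κ x) (fun y => if y ∈ C then 0
          else truncReturnTime κ C n y) ≤ expect (κ x) f := by
        refine expect_mono _ fun y => ?_
        split_ifs with hy
        · exact zero_le
        · exact ih y hy
      have h2 : (1 + expect (κ x) f) + B ≤ f x + B := by
        calc (1 + expect (κ x) f) + B = expect (κ x) f + (B + 1) := by ring
          _ ≤ expect (κ x) f + g x := by gcongr
          _ ≤ _ := hd x
      exact (add_le_add le_rfl h1).trans ((ENNReal.add_le_add_iff_right hB).1 h2)
  -- The starting point may lie in `C`, where `key` says nothing; one step is taken first, at cost
  -- 1, after which the mean of `f` is at most `f x + B`.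
  refine meanReturnTime_le κ fun n => ?_
  refine (truncReturnTime_mono_nat κ _ x (Nat.le_succ n)).trans ?_
  simp only [Nat.succ_eq_add_one]
  rw [truncReturnTime_succ]
  gcongr
  refine le_trans (expect_mono _ fun y => ?_) (le_self_add.trans (hd x))
  split_ifs with hy
  · exact zero_le
  · exact key n y hy

/-! ### Positive recurrent states inside a finite set with finite mean return times -/

open Classical in
/-- The expectation of `w (X_τ)` on the event `τ ≤ n`, where `τ` is the return time to `C`. -/
def entry (C : Set σ) (w : σ → ℝ≥0∞) : ℕ → σ → ℝ≥0∞
  | 0, _ => 0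
  | n + 1, x => expect (κ x) fun y => if y ∈ C then w y else entry C w n y

theorem entry_mono_nat (C : Set σ) (w : σ → ℝ≥0∞) (x : σ) : Monotone fun n => entry κ C w n x := by
  classical
  refine monotone_nat_of_le_succ fun n => ?_
  induction n generalizing x with
  | zero => exact zero_le
  | succ n ih =>
    simp only [entry]
    refine expect_mono _ fun y => ?_
    split_ifs
    · exact le_rfl
    · exact ih y

open Classical in
theorem entry_add_entry_le_one (C : Set σ) (c : σ) (n : ℕ) (x : σ) :
    entry κ C (fun y => if y = c then 1 else 0) n x
      + entry κ C (fun y => if y = c then 0 else 1) n x ≤ 1 := by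
  induction n generalizing x with
  | zero => simp [entry]
  | succ n ih =>
    simp only [entry]
    rw [← expect_add]
    refine (expect_mono _ fun y => ?_).trans (expect_const (κ x) 1).le
    by_cases hy : y ∈ C
    · simp only [hy, if_true]
      split_ifs <;> simp
    · simpa [hy] using ih y

-- A path that avoids `c` up to time n has either avoided `C` or first entered `C` at a point other
-- than `c`.
open Classical in
theorem survive_singleton_le (C : Set σ) (c : σ) (n : ℕ) (x : σ) :
    survive κ {c} n x ≤ survive κ C n x + entry κ C (fun y => if y = c then 0 else 1) n x := by
  induction n generalizing x with
  | zero => simp [survive]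
  | succ n ih =>
    simp only [survive_succ, entry]
    rw [← expect_add]
    refine expect_mono _ fun y => ?_
    by_cases hyc : y = c
    · simp [hyc]
    · by_cases hy : y ∈ C
      · simpa [hy, hyc] using survive_le_one κ {c} n y
      · simpa [hy, hyc] using ih y

open Classical in
theorem truncReturnTime_diff_le {C : Set σ} {c : σ} (hc : c ∈ C) (n : ℕ) (x : σ) :
    truncReturnTime κ (C \ {c}) n x ≤ truncReturnTime κ C n x
      + entry κ C (fun y => if y = c then 1 else 0) n x * truncReturnTime κ (C \ {c}) n c := by
  induction n generalizing x with
  | zero => simp [truncReturnTime]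
  | succ n ih =>
    refine le_trans ?_ (add_le_add le_rfl (mul_le_mul_right (truncReturnTime_mono_nat κ _ c
      (Nat.le_succ n)) _))
    rw [truncReturnTime_succ, truncReturnTime_succ κ C]
    simp only [entry]
    rw [← expect_mul_const, add_assoc, ← expect_add]
    gcongr
    refine expect_mono _ fun y => ?_
    by_cases hyc : y = c
    · subst hyc
      simp [hc]
    · by_cases hy : y ∈ C
      · simp [hy, hyc]
      · simpa [hy, hyc] using ih y

/-- A state that is not positive recurrent can be removed from a set whose mean return times are
all finite. -/
theorem meanReturnTime_diff_lt_top {C : Set σ} {c : σ} (hc : c ∈ C)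
    (hC : ∀ x, meanReturnTime κ C x < ⊤) (hnot : ¬ PositiveRecurrentState κ c) (x : σ) :
    meanReturnTime κ (C \ {c}) x < ⊤ := by
  classical
  -- If from `c` the set `C` were always re-entered at `c`, the return times to `c` and to `C` would
  -- agree and `c` would be positive recurrent.
  have hd : ∃ n, entry κ C (fun y => if y = c then 0 else 1) n c ≠ 0 := by
    by_contra! h
    refine hnot (lt_of_le_of_lt (ENNReal.tsum_le_tsum fun n => ?_) (hC c))
    simpa [h n] using survive_singleton_le κ C c n c
  obtain ⟨n₀, hn₀⟩ := hd
  set δ := entry κ C (fun y => if y = c then 0 else 1) n₀ c with hδ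
  have hδ1 : δ ≤ 1 := le_trans le_add_self (entry_add_entry_le_one κ C c n₀ c)
  have hδt : δ ≠ ⊤ := (hδ1.trans_lt ENNReal.one_lt_top).ne
  -- For u the truncated time from `c` and e the probability of entering at `c`, the recursion gives
  -- u ≤ E_c τ_C + e u with e + δ ≤ 1, so δ u ≤ E_c τ_C. Passing to `max n n₀` makes δ available.
  have hcb : ∀ n, truncReturnTime κ (C \ {c}) n c ≤ meanReturnTime κ C c / δ := by
    intro n
    refine (truncReturnTime_mono_nat κ _ c (le_max_left n n₀)).trans ?_
    set m := max n n₀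
    have h1 := truncReturnTime_diff_le κ hc m c
    have h2 : entry κ C (fun y => if y = c then 1 else 0) m c + δ ≤ 1 :=
      le_trans (add_le_add le_rfl (entry_mono_nat κ C _ c (le_max_right n n₀)))
        (entry_add_entry_le_one κ C c m c)
    set e := entry κ C (fun y => if y = c then 1 else 0) m c
    set u := truncReturnTime κ (C \ {c}) m c with hu
    have hut : u ≠ ⊤ := truncReturnTime_ne_top κ _ m c
    have het : e ≠ ⊤ := ((le_self_add.trans h2).trans_lt ENNReal.one_lt_top).ne
    rw [ENNReal.le_div_iff_mul_le (Or.inl hn₀) (Or.inl hδt)]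
    have h3 : u * δ + e * u ≤ meanReturnTime κ C c + e * u := by
      calc u * δ + e * u = (e + δ) * u := by ring
        _ ≤ 1 * u := by gcongr
        _ = u := one_mul u
        _ ≤ _ := h1
        _ ≤ _ := by gcongr; exact truncReturnTime_le_meanReturnTime κ C m c
    exact (ENNReal.add_le_add_iff_right (ENNReal.mul_ne_top het hut)).1 h3
  have hcbt : meanReturnTime κ C c / δ < ⊤ := ENNReal.div_lt_top (hC c).ne hn₀
  refine lt_of_le_of_lt (meanReturnTime_le κ fun n => ?_)
    (ENNReal.add_lt_top.2 ⟨hC x, ENNReal.mul_lt_top ENNReal.one_lt_top hcbt⟩)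
  refine (truncReturnTime_diff_le κ hc n x).trans ?_
  gcongr
  · exact truncReturnTime_le_meanReturnTime κ C n x
  · exact le_trans le_self_add (entry_add_entry_le_one κ C c n x)
  · exact hcb n

/-- Irreducibility is not available, so states that are not positive recurrent are deleted one at a
time; finiteness of `C` ends the process. -/
theorem positiveRecurrent_of_finite {C : Set σ} (hfin : C.Finite)
    (hC : ∀ x, meanReturnTime κ C x < ⊤) : PositiveRecurrent κ := by
  induction hn : C.ncard generalizing C with
  | zero =>
    rw [Set.ncard_eq_zero hfin] at hn
    subst hn
    exact fun x => lt_of_le_of_lt (meanReturnTime_anti κ (Set.empty_subset _) x) (hC x)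
  | succ n ih =>
    by_cases hsub : C ⊆ {y | PositiveRecurrentState κ y}
    · exact fun x => lt_of_le_of_lt (meanReturnTime_anti κ hsub x) (hC x)
    · obtain ⟨c, hc, hnot⟩ := Set.not_subset.1 hsub
      refine ih (hfin.subset Set.sdiff_subset) (meanReturnTime_diff_lt_top κ hc hC hnot) ?_
      rw [Set.ncard_sdiff_singleton_of_mem hc, hn, Nat.add_sub_cancel]

theorem survive_empty (n : ℕ) (x : σ) : survive κ ∅ n x = 1 := by
  classical
  induction n generalizing x with
  | zero => rfl
  | succ n ih =>
    rw [survive_succ]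
    simpa [ih] using expect_const (κ x) 1

/-- Otherwise the target set would be empty, and its mean return time infinite. -/
theorem PositiveRecurrent.exists_state {κ : σ → PMF σ} [Nonempty σ] (h : PositiveRecurrent κ) :
    ∃ c, PositiveRecurrentState κ c := by
  by_contra! hne
  obtain ⟨x⟩ := ‹Nonempty σ›
  have h1 := h x
  have h2 : {y | PositiveRecurrentState κ y} = ∅ := Set.eq_empty_of_forall_notMem hne
  rw [h2, meanReturnTime] at h1
  simp [survive_empty] at h1

/-! ### Existence of a stationary distribution -/

open Classical in
/-- The law of `X_n` on the event `τ_c > n` for the chain started at `c`. -/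
def taboo (c : σ) : ℕ → σ → ℝ≥0∞
  | 0, y => if y = c then 1 else 0
  | n + 1, y => if y = c then 0 else ∑' x, taboo c n x * κ x y

/-- The Markov property: one step moves from the survival factor to the taboo law. -/
theorem tsum_taboo_mul_survive (c : σ) (n k : ℕ) :
    ∑' x, taboo κ c n x * survive κ {c} (k + 1) x
      = ∑' y, taboo κ c (n + 1) y * survive κ {c} k y := by
  classical
  simp only [survive_succ, expect, taboo, ← ENNReal.tsum_mul_left]
  rw [ENNReal.tsum_comm]
  refine tsum_congr fun y => ?_
  by_cases hy : y = c
  · simp [hy]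
  · simp only [Set.mem_singleton_iff, hy, if_false, ← ENNReal.tsum_mul_right, mul_assoc]

theorem tsum_taboo (c : σ) (n : ℕ) : ∑' x, taboo κ c n x = survive κ {c} n c := by
  classical
  have h : ∀ m k, ∑' x, taboo κ c m x * survive κ {c} k x = survive κ {c} (m + k) c := by
    intro m
    induction m with
    | zero =>
      intro k
      rw [tsum_eq_single c]
      · simp [taboo]
      · intro y hy
        simp [taboo, hy]
    | succ m ih =>
      intro k
      rw [← tsum_taboo_mul_survive, ih]
      congr 1
      omega
  simpa [survive] using h n 0

/-- The mass alive at time n either returns to `c` in the next step or stays alive. -/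
theorem tsum_taboo_eq_add (c : σ) (n : ℕ) :
    ∑' x, taboo κ c n x = ∑' x, taboo κ c n x * κ x c + ∑' y, taboo κ c (n + 1) y := by
  classical
  have h : ∑' x, taboo κ c n x = ∑' y, ∑' x, taboo κ c n x * κ x y := by
    rw [ENNReal.tsum_comm]
    refine tsum_congr fun x => ?_
    rw [ENNReal.tsum_mul_left, (κ x).tsum_coe, mul_one]
  rw [h, ← tsum_ite_eq c fun y => ∑' x, taboo κ c n x * κ x y, ← ENNReal.tsum_add]
  refine tsum_congr fun y => ?_
  by_cases hy : y = c <;> simp [hy, taboo]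

/-- The cycle formula: a chain with a positive recurrent state has a stationary distribution. -/
theorem PositiveRecurrentState.exists_stationary {κ : σ → PMF σ} {c : σ}
    (hc : PositiveRecurrentState κ c) : ∃ π, IsStationary κ π := by
  classical
  let μ : σ → ℝ≥0∞ := fun y => ∑' n, taboo κ c n y
  have hmass : ∑' y, μ y = meanReturnTime κ {c} c := by
    rw [ENNReal.tsum_comm]
    exact tsum_congr fun n => tsum_taboo κ c n
  have htop : ∑' y, μ y ≠ ⊤ := hmass ▸ hc.ne
  have hμc : μ c = 1 := by
    simp only [μ]
    rw [tsum_eq_zero_add' ENNReal.summable]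
    simp [taboo]
  have h0 : ∑' y, μ y ≠ 0 := by
    intro h
    have := ENNReal.tsum_eq_zero.1 h c
    simp [hμc] at this
  have hinv : ∀ y, ∑' x, μ x * κ x y = μ y := by
    intro y
    have hexp : ∑' x, μ x * κ x y = ∑' n, ∑' x, taboo κ c n x * κ x y := by
      simp only [μ, ← ENNReal.tsum_mul_right]
      exact ENNReal.tsum_comm
    rw [hexp]
    by_cases hy : y = c
    -- At `c`, invariance says that return is certain: by telescoping, the masses lost through
    -- returns add up to the initial mass 1. The cancellation needs the finite total mass.
    · subst hy
      rw [hμc]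
      have hM : ∑' n, ∑' x, taboo κ y n x ≠ ⊤ := by
        rw [ENNReal.tsum_comm]; exact htop
      have h1 : ∑' n, ∑' x, taboo κ y n x
          = 1 + ∑' n, ∑' x, taboo κ y (n + 1) x := by
        rw [tsum_eq_zero_add' ENNReal.summable, tsum_taboo]
        rfl
      have h2 : ∑' n, ∑' x, taboo κ y n x
          = ∑' n, ∑' x, taboo κ y n x * κ x y + ∑' n, ∑' x, taboo κ y (n + 1) x := by
        rw [← ENNReal.tsum_add]
        exact tsum_congr fun n => tsum_taboo_eq_add κ y n
      have hne : ∑' n, ∑' x, taboo κ y (n + 1) x ≠ ⊤ :=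
        ne_top_of_le_ne_top hM (h1 ▸ le_add_self)
      rw [h1] at h2
      exact ((ENNReal.add_left_inj hne).1 h2).symm
    · simp only [μ]
      rw [tsum_eq_zero_add' (f := fun n => taboo κ c n y) ENNReal.summable]
      simp [taboo, hy]
  refine ⟨PMF.normalize μ h0 htop, ?_⟩
  ext y
  simp only [PMF.bind_apply, PMF.normalize_apply]
  conv_rhs => rw [← hinv y, ← ENNReal.tsum_mul_right]
  exact tsum_congr fun x => mul_right_comm _ _ _

/-! ### Moment bounds under stationary distributions -/

theorem IsStationary.expect_expect {κ : σ → PMF σ} {π : PMF σ} (h : IsStationary κ π)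
    (f : σ → ℝ≥0∞) : expect π (fun x => expect (κ x) f) = expect π f := by
  rw [← expect_bind, h]

/-- The expectation of `∑_{k < n} g (X_k)` for the chain started at `x`. -/
def cumulative (g : σ → ℝ≥0∞) : ℕ → σ → ℝ≥0∞
  | 0, _ => 0
  | n + 1, x => g x + expect (κ x) (cumulative g n)

theorem cumulative_mono {g h : σ → ℝ≥0∞} (hgh : ∀ x, g x ≤ h x) (n : ℕ) (x : σ) :
    cumulative κ g n x ≤ cumulative κ h n x := by
  induction n generalizing x with
  | zero => exact le_rfl
  | succ n ih => exact add_le_add (hgh x) (expect_mono _ ih)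

theorem cumulative_const (c : ℝ≥0∞) (n : ℕ) (x : σ) :
    cumulative κ (fun _ => c) n x = n * c := by
  induction n generalizing x with
  | zero => simp [cumulative]
  | succ n ih =>
    simp only [cumulative]
    rw [funext ih, expect_const]
    push_cast
    ring

theorem cumulative_le_of_drift {f g : σ → ℝ≥0∞} {B : ℝ≥0∞}
    (hd : ∀ x, expect (κ x) f + g x ≤ f x + B) (n : ℕ) (x : σ) :
    cumulative κ g n x ≤ f x + n * B := by
  induction n generalizing x with
  | zero => simp [cumulative]
  | succ n ih =>
    simp only [cumulative]
    calc g x + expect (κ x) (cumulative κ g n)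
        ≤ g x + expect (κ x) (fun y => f y + n * B) := by gcongr; exact expect_mono _ ih
      _ = expect (κ x) f + g x + n * B := by rw [expect_add, expect_const]; ring
      _ ≤ f x + B + n * B := by exact add_le_add (hd x) le_rfl
      _ = _ := by push_cast; ring

theorem IsStationary.expect_cumulative {κ : σ → PMF σ} {π : PMF σ} (h : IsStationary κ π)
    (g : σ → ℝ≥0∞) (n : ℕ) : expect π (cumulative κ g n) = n * expect π g := by
  induction n with
  | zero => simp [cumulative, expect]
  | succ n ih =>
    have h1 : expect π (cumulative κ g (n + 1)) = expect π g + expect π (cumulative κ g n) := by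
      rw [← h.expect_expect (cumulative κ g n), ← expect_add]
      rfl
    rw [h1, ih]
    push_cast
    ring

theorem expect_eq_iSup_min (p : PMF σ) (g : σ → ℝ≥0∞) :
    expect p g = ⨆ M : ℕ, expect p fun x => min (g x) M := by
  refine le_antisymm ?_ (iSup_le fun M => expect_mono _ fun x => min_le_left _ _)
  rw [expect, ENNReal.tsum_eq_iSup_sum]
  refine iSup_le fun F => ?_
  have hsup : ∀ x, g x = ⨆ M : ℕ, min (g x) M := by
    intro x
    rw [← inf_iSup_eq, ENNReal.iSup_natCast]
    simp
  calc ∑ x ∈ F, p x * g x = ∑ x ∈ F, ⨆ M : ℕ, p x * min (g x) M := by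
        refine Finset.sum_congr rfl fun x _ => ?_
        conv_lhs => rw [hsup x]
        rw [ENNReal.mul_iSup]
    _ = ⨆ M : ℕ, ∑ x ∈ F, p x * min (g x) M := by
        refine ENNReal.finsetSum_iSup_of_monotone fun x M N hMN => ?_
        gcongr
    _ ≤ _ := by
        refine iSup_mono fun M => ?_
        exact ENNReal.sum_le_tsum F

/-- The drift condition bounds the expectation of `g` under every stationary distribution. -/
theorem IsStationary.expect_lt_top_of_drift {κ : σ → PMF σ} {π : PMF σ} (h : IsStationary κ π)
    {f g : σ → ℝ≥0∞} {B : ℝ≥0∞} (hB : B ≠ ⊤) (hf : ∀ x, f x ≠ ⊤)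
    (hd : ∀ x, expect (κ x) f + g x ≤ f x + B) : expect π g < ⊤ := by
  classical
  -- `f` need not be integrable under `π`, so the drift inequality cannot be integrated directly.
  -- Instead `min g M` is averaged over n steps: starts in a finite set `F` cost at most `f + nB`,
  -- the others at most `nM`. Choosing `F` with tail mass times M below 1, then n above the integral
  -- of `f` over `F`, yields the bound 1 + B + 1, uniformly in M.
  refine lt_of_le_of_lt (b := 1 + B + 1) ?_ (by simp [hB.lt_top])
  rw [expect_eq_iSup_min]
  refine iSup_le fun M => ?_
  have htail : ∃ F : Finset σ, ∑' x : {x // x ∉ F}, π x * M < 1 := by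
    have hne : ∑' x, π x * (M : ℝ≥0∞) ≠ ⊤ := by
      rw [ENNReal.tsum_mul_right, π.tsum_coe, one_mul]
      exact ENNReal.natCast_ne_top M
    exact ((ENNReal.tendsto_tsum_compl_atTop_zero hne).eventually
      (gt_mem_nhds zero_lt_one)).exists
  obtain ⟨F, hF⟩ := htail
  have hFf : ∑ x ∈ F, π x * f x ≠ ⊤ :=
    (ENNReal.sum_lt_top.2 fun x _ =>
      ENNReal.mul_lt_top ((π.coe_le_one x).trans_lt ENNReal.one_lt_top) (hf x).lt_top).ne
  obtain ⟨n, hn⟩ := ENNReal.exists_nat_gt hFf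
  have hn0 : (n : ℝ≥0∞) ≠ 0 := (lt_of_le_of_lt (zero_le) hn).ne'
  have hnt : (n : ℝ≥0∞) ≠ ⊤ := ENNReal.natCast_ne_top n
  set gM : σ → ℝ≥0∞ := fun x => min (g x) M
  have hb : ∀ x, cumulative κ gM n x
      ≤ (if x ∈ F then f x else 0) + n * B + n * (if x ∈ F then 0 else (M : ℝ≥0∞)) := by
    intro x
    by_cases hx : x ∈ F
    · simp only [hx, if_true, mul_zero, add_zero]
      exact (cumulative_mono κ (fun y => min_le_left _ _) n x).trans
        (cumulative_le_of_drift κ hd n x)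
    · simp only [hx, if_false]
      refine le_trans ?_ le_add_self
      rw [← cumulative_const κ (M : ℝ≥0∞) n x]
      exact cumulative_mono κ (fun y => min_le_right _ _) n x
  have h1 : expect π (fun x => if x ∈ F then f x else 0) ≤ n := by
    refine le_trans (le_of_eq ?_) hn.le
    rw [expect, tsum_eq_sum (s := F)]
    · exact Finset.sum_congr rfl fun x hx => by simp [hx]
    · intro x hx
      simp [hx]
  have h2 : expect π (fun x => if x ∈ F then 0 else (M : ℝ≥0∞)) ≤ 1 := by
    refine le_trans (le_of_eq ?_) hF.le
    have := tsum_subtype {x | x ∉ F} fun x => π x * (M : ℝ≥0∞)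
    refine Eq.trans ?_ this.symm
    rw [expect]
    refine tsum_congr fun x => ?_
    by_cases hx : x ∈ F <;> simp [hx]
  have h3 : n * expect π gM ≤ n * (1 + B + 1) := by
    rw [← h.expect_cumulative]
    refine (expect_mono _ hb).trans ?_
    rw [expect_add, expect_add, expect_const, expect_const_mul]
    calc _ ≤ (n : ℝ≥0∞) + n * B + n * 1 := by gcongr
      _ = _ := by ring
  exact (ENNReal.mul_le_mul_iff_right hn0 hnt).1 h3

theorem stable_of_drift {κ : σ → PMF σ} [Nonempty σ] {f g : σ → ℝ≥0∞} {B : ℝ≥0∞} (hB : B ≠ ⊤)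
    (hf : ∀ x, f x ≠ ⊤) (hd : ∀ x, expect (κ x) f + g x ≤ f x + B)
    (hg : {x | g x ≤ B + 1}.Finite) :
    PositiveRecurrent κ ∧ (∃ π, IsStationary κ π) ∧
      ∀ π, IsStationary κ π → expect π g < ⊤ := by
  have hpr : PositiveRecurrent κ := positiveRecurrent_of_finite κ hg fun x =>
    lt_of_le_of_lt (meanReturnTime_le_of_drift κ hB hd x)
      (by simp [(hf x).lt_top, hB.lt_top])
  obtain ⟨c, hc⟩ := hpr.exists_state
  exact ⟨hpr, hc.exists_stationary, fun π h => h.expect_lt_top_of_drift hB hf hd⟩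

end Chain

/-! ### Additive functionals of random lists -/

section Lists

variable {β γ : Type*}

theorem expect_concatLaw_sum (w : β → ℕ) (ds : List (PMF (List β))) :
    expect (concatLaw ds) (fun b => ((b.map w).sum : ℝ≥0∞))
      = (ds.map fun d => expect d fun b => ((b.map w).sum : ℝ≥0∞)).sum := by
  induction ds with
  | nil => simp [concatLaw, expect_pure]
  | cons d ds ih =>
    simp only [concatLaw, expect_bind, expect_map, List.map_append, List.sum_append, Nat.cast_add,
      expect_add, expect_const, List.map_cons, List.sum_cons, ih]

theorem expect_concatLaw_sum_sq_lt_top (w : β → ℕ) (ds : List (PMF (List β)))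
    (h : ∀ d ∈ ds, expect d (fun b => ((b.map w).sum : ℝ≥0∞) ^ 2) < ⊤) :
    expect (concatLaw ds) (fun b => ((b.map w).sum : ℝ≥0∞) ^ 2) < ⊤ := by
  induction ds with
  | nil => simp [concatLaw, expect_pure]
  | cons d ds ih =>
    have h1 := h d (by simp)
    have h2 := ih fun d' hd' => h d' (by simp [hd'])
    simp only [concatLaw, expect_bind, expect_map, List.map_append, List.sum_append, Nat.cast_add]
    refine lt_of_le_of_lt (b := expect d fun a => expect (concatLaw ds) fun b =>
      2 * ((a.map w).sum : ℝ≥0∞) ^ 2 + 2 * ((b.map w).sum : ℝ≥0∞) ^ 2) ?_ ?_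
    · refine expect_mono _ fun a => expect_mono _ fun b => ?_
      exact_mod_cast (add_sq_le (a := (a.map w).sum) (b := (b.map w).sum)).trans_eq (mul_add _ _ _)
    · simp only [expect_add, expect_const, expect_const_mul]
      exact ENNReal.add_lt_top.2
        ⟨ENNReal.mul_lt_top (by simp) h1, ENNReal.mul_lt_top (by simp) h2⟩

theorem expect_iidList_sum (w : β → ℕ) (q : PMF β) (n : ℕ) :
    expect (iidList q n) (fun b => ((b.map w).sum : ℝ≥0∞)) = n * expect q fun b => (w b : ℝ≥0∞) := by
  induction n with
  | zero => simp [iidList, expect_pure]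
  | succ n ih =>
    simp only [iidList, expect_bind, expect_map, List.map_cons, List.sum_cons, Nat.cast_add,
      expect_add, expect_const, ih]
    push_cast
    ring

theorem expect_iidList_sum_sq_le {w : β → ℕ} {c : ℕ} (hw : ∀ b, w b ≤ c) (q : PMF β) (n : ℕ) :
    expect (iidList q n) (fun b => ((b.map w).sum : ℝ≥0∞) ^ 2) ≤ ((n * c : ℕ) : ℝ≥0∞) ^ 2 := by
  have hlen : ∀ n, ∀ b ∈ (iidList q n).support, b.length = n := by
    intro n
    induction n with
    | zero => simp [iidList]
    | succ n ih =>
      intro b hb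
      simp only [iidList, PMF.mem_support_bind_iff, PMF.mem_support_map_iff] at hb
      obtain ⟨x, -, b', hb', rfl⟩ := hb
      simp [ih b' hb']
  refine (expect_mono_support _ fun b hb => ?_).trans (expect_const _ _).le
  have h1 : (b.map w).sum ≤ n * c := by
    have h2 := List.sum_le_card_nsmul (b.map w) c (by simpa using fun x _ => hw x)
    simpa [hlen n b hb] using h2
  gcongr

end Lists

namespace System

variable {L J : ℕ} (sys : System L J)

/-! ### Requirements and quanta -/

theorem S_pos (l : Fin L) : 0 < sys.S l := by
  have h1 : Real.log (sys.Pe l) < 0 := Real.log_neg (sys.Pe_pos l) (sys.Pe_lt_one l)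
  have h2 : 0 ≤ Real.log (sys.M l) := Real.log_natCast_nonneg _
  have h3 := mul_nonneg sys.ρ_pos.le h2
  unfold S
  linarith

/-- The interference-plus-noise power seen by a message of received power class `j`. -/
def interference (j : Fin J) (t : sys.Schedule) : ℝ :=
  sys.N0 * sys.W + ((∑ l', ∑ j', (t.1 l' j' : ℝ) * sys.P j') - sys.P j)

theorem interference_pos {l : Fin L} {j : Fin J} {t : sys.Schedule} (h : 0 < t.1 l j) :
    0 < sys.interference j t := by
  have h0 : ∀ l' j', 0 ≤ (t.1 l' j' : ℝ) * sys.P j' := fun l' j' =>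
    mul_nonneg (Nat.cast_nonneg _) (sys.P_pos j').le
  have h1 : sys.P j ≤ (t.1 l j : ℝ) * sys.P j :=
    le_mul_of_one_le_left (sys.P_pos j).le (by exact_mod_cast h)
  have h2 : (t.1 l j : ℝ) * sys.P j ≤ ∑ j', (t.1 l j' : ℝ) * sys.P j' :=
    Finset.single_le_sum (f := fun j' => (t.1 l j' : ℝ) * sys.P j') (fun _ _ => h0 _ _)
      (Finset.mem_univ j)
  have h3 : ∑ j', (t.1 l j' : ℝ) * sys.P j' ≤ ∑ l', ∑ j', (t.1 l' j' : ℝ) * sys.P j' :=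
    Finset.single_le_sum (f := fun l' => ∑ j', (t.1 l' j' : ℝ) * sys.P j')
      (fun _ _ => Finset.sum_nonneg fun _ _ => h0 _ _) (Finset.mem_univ l)
  have h4 := mul_pos sys.N0_pos sys.W_pos
  unfold interference
  linarith

theorem quantum_eq {l : Fin L} {j : Fin J} {t : sys.Schedule} (h : 0 < t.1 l j) :
    sys.quantum j t
      = sys.ρ * Real.log (1 + sys.P j / ((1 + sys.ρ) * sys.interference j t)) := by
  have h1 : 0 < ∑ l, t.1 l j :=
    lt_of_lt_of_le h (Finset.single_le_sum (f := fun l => t.1 l j) (fun _ _ => Nat.zero_le _)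
      (Finset.mem_univ l))
  rw [quantum, if_pos h1]
  rfl

theorem quantum_pos {l : Fin L} {j : Fin J} {t : sys.Schedule} (h : 0 < t.1 l j) :
    0 < sys.quantum j t := by
  have h1 := sys.interference_pos h
  have h2 := sys.ρ_pos
  have h3 := sys.P_pos j
  rw [sys.quantum_eq h]
  refine mul_pos h2 (Real.log_pos ?_)
  have : 0 < sys.P j / ((1 + sys.ρ) * sys.interference j t) := by positivity
  linarith

theorem quantum_nonneg (j : Fin J) (t : sys.Schedule) : 0 ≤ sys.quantum j t := by
  by_cases h : ∃ l, 0 < t.1 l j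
  · obtain ⟨l, hl⟩ := h
    exact (sys.quantum_pos hl).le
  · push Not at h
    have h1 : ∑ l, t.1 l j = 0 := Finset.sum_eq_zero fun l _ => Nat.le_zero.1 (h l)
    simp [quantum, h1]

/-- Fewer transmissions give larger quanta. -/
theorem quantum_anti {l : Fin L} {j : Fin J} {t z : sys.Schedule} (htz : t ≤ z)
    (h : 0 < t.1 l j) : sys.quantum j z ≤ sys.quantum j t := by
  have hz : 0 < z.1 l j := lt_of_lt_of_le h (htz l j)
  have h1 := sys.interference_pos h
  have hP := sys.P_pos j
  have hρ := sys.ρ_pos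
  have h2 : sys.interference j t ≤ sys.interference j z := by
    unfold interference
    gcongr with l' _ j' _
    · exact (sys.P_pos j').le
    · exact htz l' j'
  rw [sys.quantum_eq h, sys.quantum_eq hz]
  have h3 := sys.interference_pos hz
  gcongr

variable {sys} in
theorem Residual.pos {l : Fin L} {j : Fin J} {z : sys.Schedule} {x : ℝ}
    (h : sys.Residual l j z x) : 0 < x := by
  cases h with
  | fresh => exact sys.S_pos l
  | served t ht hx hpos => exact hpos

variable {sys} in
theorem Residual.le {l : Fin L} {j : Fin J} {z : sys.Schedule} {x : ℝ}
    (h : sys.Residual l j z x) : x ≤ sys.S l := by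
  induction h with
  | fresh => exact le_rfl
  | served t ht hx hpos ih => linarith [sys.quantum_nonneg j t]

/-- There are finitely many schedules, so the nonzero quanta exceed a common δ > 0 and only
boundedly many of them fit into `S l`. This makes `Message` finite. -/
theorem finite_residual (l : Fin L) (j : Fin J) (z : sys.Schedule) :
    {x | sys.Residual l j z x}.Finite := by
  obtain ⟨δ, hδ, hmin⟩ : ∃ δ > 0, ∀ t : sys.Schedule,
      sys.quantum j t = 0 ∨ δ ≤ sys.quantum j t := by
    by_cases hne : (Finset.univ.filter fun t : sys.Schedule => sys.quantum j t ≠ 0).Nonempty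
    · obtain ⟨t₀, ht₀, hmin⟩ := Finset.exists_min_image _ (fun t => sys.quantum j t) hne
      simp only [Finset.mem_filter, Finset.mem_univ, true_and] at ht₀ hmin
      exact ⟨_, lt_of_le_of_ne (sys.quantum_nonneg j t₀) (Ne.symm ht₀), fun t =>
        or_iff_not_imp_left.2 (hmin t)⟩
    · refine ⟨1, one_pos, fun t => Or.inl ?_⟩
      by_contra h
      exact hne ⟨t, by simp [h]⟩
  have key : ∀ k : ℕ, {x | sys.Residual l j z x ∧ sys.S l - k * δ < x}.Finite := by
    intro k
    induction k with
    | zero =>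
      refine Set.finite_empty.subset fun x hx => ?_
      have h1 := hx.1.le
      have h2 := hx.2
      simp only [Nat.cast_zero, zero_mul, sub_zero] at h2
      exact absurd h1 (not_le.2 h2)
    | succ k ih =>
      refine ((Set.finite_singleton (sys.S l)).union (ih.image2 (fun x q => x - q)
        (Set.finite_range fun t : sys.Schedule => sys.quantum j t))).subset ?_
      rintro x ⟨hx, hlt⟩
      -- The inner induction absorbs zero quanta, which leave the residual unchanged; a nonzero
      -- quantum leads back to level k.
      induction hx with
      | fresh => exact Or.inl rfl
      | @served x t ht hx hpos ihx =>
        push_cast at hlt ihx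
        rcases hmin t with h0 | h0
        · rw [h0, sub_zero] at hlt ⊢
          exact ihx hlt
        · exact Or.inr ⟨x, ⟨hx, by linarith⟩, _, ⟨t, rfl⟩, rfl⟩
  obtain ⟨k, hk⟩ := exists_nat_gt (sys.S l / δ)
  rw [div_lt_iff₀ hδ] at hk
  exact (key k).subset fun x hx => ⟨hx, by linarith [Residual.pos hx]⟩

instance : Finite sys.Message := by
  have : ∀ i : Fin L × Fin J × sys.Schedule, Finite {x // sys.Residual i.1 i.2.1 i.2.2 x} :=
    fun i => (sys.finite_residual _ _ _).to_subtype
  refine Finite.of_injective (fun m : sys.Message =>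
    (⟨(m.l, m.j, m.z), ⟨m.x, m.residual⟩⟩ :
      Σ i : Fin L × Fin J × sys.Schedule, {x // sys.Residual i.1 i.2.1 i.2.2 x})) ?_
  rintro ⟨l, j, z, hz, x, hx⟩ ⟨l', j', z', hz', x', hx'⟩ h
  simp only [Sigma.mk.injEq, Prod.mk.injEq] at h
  obtain ⟨⟨rfl, rfl, rfl⟩, h⟩ := h
  have := Subtype.ext_iff.1 (eq_of_heq h)
  simp only at this
  subst this
  rfl

/-! ### Workloads -/

/-- The number of slots with the complete schedule `z` that a message of class `(l, j)` needs. -/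
def services (l : Fin L) (j : Fin J) (z : sys.Schedule) : ℕ := ⌈sys.S l / sys.quantum j z⌉₊

theorem services_pos {l : Fin L} {j : Fin J} {z : sys.Schedule} (h : 0 < z.1 l j) :
    0 < sys.services l j z :=
  Nat.ceil_pos.2 (div_pos (sys.S_pos l) (sys.quantum_pos h))

theorem ceilMul_S {l : Fin L} {j : Fin J} {z : sys.Schedule} (h : 0 < z.1 l j) :
    ceilMul (sys.S l) (sys.quantum j z) = sys.services l j z * sys.quantum j z := by
  have hq := sys.quantum_pos h
  have hs : IsLeast {n : ℕ | 1 ≤ n ∧ sys.S l ≤ n * sys.quantum j z} (sys.services l j z) := by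
    refine ⟨⟨sys.services_pos h, ?_⟩, fun n hn => ?_⟩
    · rw [← div_le_iff₀ hq]
      exact Nat.le_ceil _
    · refine Nat.ceil_le.2 ?_
      rw [div_le_iff₀ hq]
      exact hn.2
  rw [ceilMul, hs.csInf_eq]

/-- The number of slots with the complete assigned schedule that a message still needs. -/
def remaining (m : sys.Message) : ℕ := ⌈m.x / sys.quantum m.j m.z⌉₊

theorem remaining_pos (m : sys.Message) : 0 < sys.remaining m :=
  Nat.ceil_pos.2 (div_pos m.residual.pos (sys.quantum_pos m.z_pos))

theorem remaining_le (m : sys.Message) : sys.remaining m ≤ sys.services m.l m.j m.z := by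
  unfold remaining services
  have := sys.quantum_pos m.z_pos
  gcongr
  exact m.residual.le

/-- The contribution of a message to the workload of the subclass `(l, j, z)`. -/
def weight (l : Fin L) (j : Fin J) (z : sys.Schedule) (m : sys.Message) : ℕ :=
  if m.l = l ∧ m.j = j ∧ m.z = z then sys.remaining m else 0

theorem weight_le (l : Fin L) (j : Fin J) (z : sys.Schedule) (m : sys.Message) :
    sys.weight l j z m ≤ if m.l = l ∧ m.j = j ∧ m.z = z then sys.services l j z else 0 := by
  unfold weight
  split_ifs with h
  · obtain ⟨rfl, rfl, rfl⟩ := h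
    exact sys.remaining_le m
  · exact le_rfl

/-- The workload of the subclass `(l, j, z)`. -/
def workload (l : Fin L) (j : Fin J) (z : sys.Schedule) (α : sys.State) : ℕ :=
  (α.map (sys.weight l j z)).sum

theorem workload_append (l : Fin L) (j : Fin J) (z : sys.Schedule) (α b : sys.State) :
    sys.workload l j z (α ++ b) = sys.workload l j z α + sys.workload l j z b := by
  simp [workload]

/-- Used when a subclass has too few messages to fill its schedule: its workload is then bounded. -/
theorem workload_le (l : Fin L) (j : Fin J) (z : sys.Schedule) (α : sys.State) :
    sys.workload l j z α ≤ sys.numSubclass α l j z * sys.services l j z := by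
  induction α with
  | nil => simp [workload]
  | cons m α ih =>
    have h := sys.weight_le l j z m
    simp only [workload, numSubclass, List.map_cons, List.sum_cons, List.countP_cons,
      decide_eq_true_eq] at ih ⊢
    split_ifs at h ⊢ <;> linarith

/-- Every message still needs at least one slot, and its own schedule is among those summed over by
`z_pos`. -/
theorem length_le_sum_workload (α : sys.State) :
    α.length ≤ ∑ l, ∑ j, ∑ z : {s : sys.Schedule // 0 < s.1 l j}, sys.workload l j z α := by
  induction α with
  | nil => simp
  | cons m α ih =>
    have h1 : ∀ l j (z : sys.Schedule), sys.workload l j z (m :: α)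
        = sys.weight l j z m + sys.workload l j z α := fun l j z => by simp [workload]
    simp only [h1, Finset.sum_add_distrib, List.length_cons]
    have h2 : 1 ≤ ∑ l, ∑ j, ∑ z : {s : sys.Schedule // 0 < s.1 l j}, sys.weight l j z m := by
      have h3 : 1 ≤ sys.weight m.l m.j m.z m := by
        simpa [weight] using Nat.succ_le_of_lt (sys.remaining_pos m)
      calc 1 ≤ sys.weight m.l m.j m.z m := h3
        _ ≤ ∑ z : {s : sys.Schedule // 0 < s.1 m.l m.j}, sys.weight m.l m.j z m :=
          Finset.single_le_sum (f := fun z : {s : sys.Schedule // 0 < s.1 m.l m.j} =>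
            sys.weight m.l m.j z m) (fun _ _ => Nat.zero_le _)
            (Finset.mem_univ (⟨m.z, m.z_pos⟩ : {s : sys.Schedule // 0 < s.1 m.l m.j}))
        _ ≤ ∑ j, ∑ z : {s : sys.Schedule // 0 < s.1 m.l j}, sys.weight m.l j z m :=
          Finset.single_le_sum (f := fun j => ∑ z : {s : sys.Schedule // 0 < s.1 m.l j},
            sys.weight m.l j z m) (fun _ _ => Nat.zero_le _) (Finset.mem_univ m.j)
        _ ≤ _ := Finset.single_le_sum (f := fun l => ∑ j,
            ∑ z : {s : sys.Schedule // 0 < s.1 l j}, sys.weight l j z m)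
            (fun _ _ => Nat.zero_le _) (Finset.mem_univ m.l)
    omega

/-- Since `t ≤ m.z`, the quantum received is at least that of the complete schedule
(`quantum_anti`), so the ceiling drops by at least one; a departing message had at least one slot
left. -/
theorem weight_serveMessage {t : sys.Schedule} {m : sys.Message} (ht : t ≤ m.z)
    (hpos : 0 < t.1 m.l m.j) (l : Fin L) (j : Fin J) (z : sys.Schedule) :
    (sys.serveMessage t m ht).elim 0 (sys.weight l j z)
      + (if m.l = l ∧ m.j = j ∧ m.z = z then 1 else 0) ≤ sys.weight l j z m := by
  have hq := sys.quantum_pos m.z_pos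
  by_cases hx : 0 < m.x - sys.quantum m.j t
  · rw [serveMessage, dif_pos hx, Option.elim_some]
    unfold weight
    by_cases hc : m.l = l ∧ m.j = j ∧ m.z = z
    · rw [if_pos hc, if_pos hc, if_pos hc]
      have h1 := sys.quantum_anti ht hpos
      have h2 : (m.x - sys.quantum m.j t) / sys.quantum m.j m.z + 1
          ≤ m.x / sys.quantum m.j m.z := by
        rw [div_add_one hq.ne', div_le_div_iff_of_pos_right hq]
        linarith
      unfold remaining
      rw [← Nat.ceil_add_one (div_pos hx hq).le]
      exact Nat.ceil_le_ceil h2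
    · simp [hc]
  · rw [serveMessage, dif_neg hx, Option.elim_none]
    unfold weight
    have := sys.remaining_pos m
    split_ifs <;> omega

theorem sum_map_filterMap {β γ : Type*} (f : β → Option γ) (w : γ → ℕ) (xs : List β) :
    ((xs.filterMap f).map w).sum = (xs.map fun i => (f i).elim 0 w).sum := by
  induction xs with
  | nil => rfl
  | cons x xs ih =>
    rw [List.filterMap_cons, List.map_cons, List.sum_cons, ← ih]
    cases f x <;> simp

theorem workload_serve (r : sys.SelectionRule) (α : sys.State) (s : sys.Schedule)
    (l : Fin L) (j : Fin J) (z : sys.Schedule) :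
    sys.workload l j z (sys.serve r α s)
      + (if s = z then (sys.transmitted α s).1 l j else 0) ≤ sys.workload l j z α := by
  classical
  have h1 : sys.workload l j z α = ∑ i, sys.weight l j z (α.get i) := by
    rw [Fin.sum_univ_def, workload]
    conv_lhs => rw [← List.map_get_finRange α]
    rw [List.map_map]
    rfl
  have h2 : (if s = z then (sys.transmitted α s).1 l j else 0)
      = ∑ i, if i ∈ r.sel α s ∧ (α.get i).l = l ∧ (α.get i).j = j ∧ (α.get i).z = z
        then 1 else 0 := by
    rw [← Finset.card_filter]
    split_ifs with h
    · subst h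
      rw [← r.sel_card α s l j]
      congr 1
      ext i
      simp only [Finset.mem_filter, Finset.mem_univ, true_and]
      exact ⟨fun ⟨a, b, c⟩ => ⟨a, b, c, r.sel_schedule α s i a⟩, fun ⟨a, b, c, _⟩ => ⟨a, b, c⟩⟩
    · symm
      rw [Finset.card_eq_zero, Finset.filter_eq_empty_iff]
      rintro i - ⟨a, -, -, c⟩
      exact h ((r.sel_schedule α s i a).symm.trans c)
  rw [h1, h2, workload, serve, sum_map_filterMap, ← Fin.sum_univ_def, ← Finset.sum_add_distrib]
  refine Finset.sum_le_sum fun i _ => ?_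
  by_cases hi : i ∈ r.sel α s
  · simp only [hi, dite_true, true_and]
    refine sys.weight_serveMessage _ ?_ l j z
    rw [← r.sel_card]
    exact Finset.card_pos.2 ⟨i, by simp [hi]⟩
  · simp [hi]

/-! ### Arrivals -/

theorem weight_newMessage (l l' : Fin L) (j j' : Fin J) (z : sys.Schedule)
    (z' : {s : sys.Schedule // 0 < s.1 l' j'}) :
    sys.weight l j z (sys.newMessage l' j' z')
      = if l' = l ∧ j' = j ∧ z'.1 = z then sys.services l j z else 0 := by
  by_cases h : l' = l ∧ j' = j ∧ z'.1 = z
  · rw [if_pos h]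
    obtain ⟨rfl, rfl, rfl⟩ := h
    simp [weight, newMessage, remaining, services]
  · simp [weight, newMessage, h]

/-- The law of the arriving messages of class `(l, j)`. -/
def classLaw (a : Fin L → Fin J → PMF ℕ) (q : sys.Classification) (l : Fin L) (j : Fin J) :
    PMF sys.State :=
  (a l j).bind fun k => (iidList (q l j) k).map (List.map (sys.newMessage l j))

/-- Wald's identity, the schedules being assigned independently of the number of arrivals. -/
theorem expect_classLaw_workload (a : Fin L → Fin J → PMF ℕ) (q : sys.Classification)
    (l l' : Fin L) (j j' : Fin J) (z : sys.Schedule) :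
    expect (sys.classLaw a q l' j') (fun b => (sys.workload l j z b : ℝ≥0∞))
      = expect (a l' j') (fun k => (k : ℝ≥0∞))
        * expect (q l' j') fun z' => (sys.weight l j z (sys.newMessage l' j' z') : ℝ≥0∞) := by
  simp only [classLaw, expect_bind, expect_map, workload, List.map_map]
  rw [← expect_mul_const]
  congr 1
  funext k
  exact expect_iidList_sum _ _ _

/-- Only class `(l, j)` feeds this subclass; each arrival joins it with probability `q l j z` and
brings `services l j z` units. -/
theorem expect_arrivalLaw_workload (a : Fin L → Fin J → PMF ℕ) (q : sys.Classification)
    (l : Fin L) (j : Fin J) (z : {s : sys.Schedule // 0 < s.1 l j}) :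
    expect (sys.arrivalLaw a q) (fun b => (sys.workload l j z b : ℝ≥0∞))
      = expect (a l j) (fun k => (k : ℝ≥0∞)) * (q l j z * sys.services l j z) := by
  have h1 : expect (sys.arrivalLaw a q) (fun b => (sys.workload l j z b : ℝ≥0∞))
      = ∑ l', ∑ j', expect (sys.classLaw a q l' j')
        (fun b => (sys.workload l j z b : ℝ≥0∞)) := by
    simp only [arrivalLaw, workload]
    rw [expect_concatLaw_sum]
    simp only [List.flatMap, List.map_flatten, List.sum_flatten, List.map_map,
      Fin.sum_univ_def, Function.comp_def, classLaw]
  rw [h1, Finset.sum_eq_single l, Finset.sum_eq_single j]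
  · rw [expect_classLaw_workload]
    congr 1
    rw [expect, tsum_eq_single z]
    · simp [weight_newMessage]
    · intro z' hz'
      have : z'.1 ≠ z.1 := fun h => hz' (Subtype.ext h)
      simp [weight_newMessage, this]
  · intro j' _ hj'
    rw [expect_classLaw_workload]
    simp [weight_newMessage, hj', expect]
  · simp
  · intro l' _ hl'
    refine Finset.sum_eq_zero fun j' _ => ?_
    rw [expect_classLaw_workload]
    simp [weight_newMessage, hl', expect]
  · simp

theorem expect_arrivalLaw_workload_sq_lt_top {a : Fin L → Fin J → PMF ℕ}
    (ha : ∀ l j, expect (a l j) (fun k => (k : ℝ≥0∞) ^ 2) < ⊤) (q : sys.Classification)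
    (l : Fin L) (j : Fin J) (z : sys.Schedule) :
    expect (sys.arrivalLaw a q) (fun b => (sys.workload l j z b : ℝ≥0∞) ^ 2) < ⊤ := by
  simp only [arrivalLaw, workload]
  refine expect_concatLaw_sum_sq_lt_top _ _ fun d hd => ?_
  simp only [List.mem_flatMap, List.mem_map] at hd
  obtain ⟨l', -, j', -, rfl⟩ := hd
  simp only [expect_bind, expect_map, List.map_map]
  refine lt_of_le_of_lt (expect_mono _ fun k =>
    expect_iidList_sum_sq_le (c := sys.services l j z) (fun z' => ?_) _ k) ?_
  · simp only [Function.comp, weight_newMessage]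
    split_ifs
    · exact le_rfl
    · exact Nat.zero_le _
  · simp only [Nat.cast_mul, mul_pow, expect_mul_const]
    exact ENNReal.mul_lt_top (ha l' j') (by finiteness)

end System

namespace System

variable {L J : ℕ} (sys : System L J)

/-! ### Drift of the squared workloads -/

theorem schedule_le_K (s : sys.Schedule) (l : Fin L) (j : Fin J) : s.1 l j ≤ sys.K :=
  calc s.1 l j ≤ ∑ j', s.1 l j' :=
        Finset.single_le_sum (f := fun j' => s.1 l j') (fun _ _ => Nat.zero_le _)
          (Finset.mem_univ j)
    _ ≤ ∑ l', ∑ j', s.1 l' j' :=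
        Finset.single_le_sum (f := fun l' => ∑ j', s.1 l' j') (fun _ _ => Nat.zero_le _)
          (Finset.mem_univ l)
    _ ≤ _ := s.2

-- The left side credits the full service z_lj although only d = `transmitted` messages are served.
-- If d < z_lj, the subclass has fewer than K messages, so V ≤ K N and the credit exceeds the truth
-- by at most 2K²N; the remaining K² bounds d².
open Classical in
theorem workload_sq_step (r : sys.SelectionRule) (α b : sys.State) (s : sys.Schedule)
    (l : Fin L) (j : Fin J) (z : sys.Schedule) :
    sys.workload l j z (sys.serve r α s ++ b) ^ 2
        + 2 * sys.workload l j z α * (if s = z then z.1 l j else 0)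
      ≤ sys.workload l j z α ^ 2 + 2 * sys.workload l j z α * sys.workload l j z b
        + sys.workload l j z b ^ 2 + (sys.K ^ 2 + 2 * (sys.K ^ 2 * sys.services l j z)) := by
  have h1 := sys.workload_serve r α s l j z
  have h2 := sys.workload_le l j z α
  have h3 := sys.schedule_le_K z l j
  rw [sys.workload_append]
  set V := sys.workload l j z α
  set U := sys.workload l j z (sys.serve r α s)
  set A := sys.workload l j z b
  set N := sys.services l j z
  by_cases hs : s = z
  · subst hs
    simp only [if_true] at h1 ⊢
    have h4 : (sys.transmitted α s).1 l j ≤ sys.K := sys.schedule_le_K _ l j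
    have h5 : V * s.1 l j ≤ V * (sys.transmitted α s).1 l j + sys.K ^ 2 * N := by
      have ht : (sys.transmitted α s).1 l j = min (s.1 l j) (sys.numSubclass α l j s) := rfl
      rcases le_total (s.1 l j) (sys.numSubclass α l j s) with h | h
      · rw [ht, min_eq_left h]
        exact Nat.le_add_right _ _
      · calc V * s.1 l j ≤ (sys.K * N) * sys.K :=
              Nat.mul_le_mul (h2.trans (Nat.mul_le_mul_right _ (h.trans h3))) h3
          _ = sys.K ^ 2 * N := by ring
          _ ≤ _ := Nat.le_add_left _ _
    generalize (sys.transmitted α s).1 l j = d at *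
    clear_value V U A N
    -- e is the decrease beyond d; naming it avoids subtraction in ℕ.
    obtain ⟨e, rfl⟩ : ∃ e, V = U + d + e := Nat.exists_eq_add_of_le h1
    have h6 : d ^ 2 ≤ sys.K ^ 2 := Nat.pow_le_pow_left h4 2
    have h7 : (U + A) ^ 2 + 2 * ((U + d + e) * d)
        ≤ (U + d + e) ^ 2 + 2 * (U + d + e) * A + A ^ 2 + d ^ 2 := by
      ring_nf
      nlinarith [Nat.zero_le (U * e), Nat.zero_le (d * A), Nat.zero_le (e * A),
        Nat.zero_le (e ^ 2), Nat.zero_le (e * d)]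
    calc (U + A) ^ 2 + 2 * (U + d + e) * s.1 l j
        = (U + A) ^ 2 + 2 * ((U + d + e) * s.1 l j) := by ring
      _ ≤ (U + A) ^ 2 + 2 * ((U + d + e) * d + sys.K ^ 2 * N) := by gcongr
      _ = (U + A) ^ 2 + 2 * ((U + d + e) * d) + 2 * (sys.K ^ 2 * N) := by ring
      _ ≤ _ := by omega
  · simp only [hs, if_false, mul_zero, add_zero] at h1 ⊢
    calc (U + A) ^ 2 ≤ (V + A) ^ 2 := by gcongr
      _ = V ^ 2 + 2 * V * A + A ^ 2 := by ring
      _ ≤ _ := Nat.le_add_right _ _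

theorem expect_workload_sq_le (a : Fin L → Fin J → PMF ℕ) (p : PMF sys.Schedule)
    (q : sys.Classification) (r : sys.SelectionRule) (l : Fin L) (j : Fin J) (z : sys.Schedule)
    (α : sys.State) :
    expect (sys.chain a p q r α) (fun y => (sys.workload l j z y : ℝ≥0∞) ^ 2)
        + 2 * sys.workload l j z α * (p z * z.1 l j)
      ≤ (sys.workload l j z α : ℝ≥0∞) ^ 2
        + 2 * sys.workload l j z α
          * expect (sys.arrivalLaw a q) (fun b => (sys.workload l j z b : ℝ≥0∞))
        + (expect (sys.arrivalLaw a q) (fun b => (sys.workload l j z b : ℝ≥0∞) ^ 2)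
          + (sys.K ^ 2 + 2 * (sys.K ^ 2 * sys.services l j z) : ℕ)) := by
  classical
  have hp : p z * z.1 l j
      = expect p fun s => ((if s = z then z.1 l j else 0 : ℕ) : ℝ≥0∞) := by
    rw [expect, tsum_eq_single z]
    · simp
    · intro s hs
      simp [hs]
  rw [hp]
  simp only [chain, expect_bind, expect_map]
  rw [← expect_const_mul, ← expect_add]
  refine (expect_mono _ fun s => ?_).trans (expect_const p _).le
  have h := expect_mono (sys.arrivalLaw a q) (f := fun b =>
      (sys.workload l j z (sys.serve r α s ++ b) : ℝ≥0∞) ^ 2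
        + 2 * sys.workload l j z α * ((if s = z then z.1 l j else 0 : ℕ) : ℝ≥0∞))
    (g := fun b => (sys.workload l j z α : ℝ≥0∞) ^ 2
      + 2 * sys.workload l j z α * (sys.workload l j z b : ℝ≥0∞)
      + (sys.workload l j z b : ℝ≥0∞) ^ 2
      + (sys.K ^ 2 + 2 * (sys.K ^ 2 * sys.services l j z) : ℕ))
    fun b => by exact_mod_cast sys.workload_sq_step r α b s l j z
  simpa only [expect_add, expect_const, expect_const_mul, add_assoc] using h

/-- With ε the excess of offered service over load, V² has drift at most a constant minus 2εV; the
factor c = 1/(2ε) normalises the linear term to V. Neither constant depends on the rule or the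
state. -/
theorem workload_drift {a : Fin L → Fin J → PMF ℕ}
    (ha : ∀ l j, expect (a l j) (fun k => (k : ℝ≥0∞) ^ 2) < ⊤) {p : PMF sys.Schedule}
    {q : sys.Classification} {l : Fin L} {j : Fin J} {z : {s : sys.Schedule // 0 < s.1 l j}}
    (hlt : expect (a l j) (fun k => (k : ℝ≥0∞)) * (q l j z * sys.services l j z)
      < p z * z.1.1 l j) :
    ∃ c B : ℝ≥0∞, c ≠ ⊤ ∧ B ≠ ⊤ ∧ ∀ r α,
      expect (sys.chain a p q r α) (fun y => c * (sys.workload l j z y : ℝ≥0∞) ^ 2)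
        + sys.workload l j z α ≤ c * (sys.workload l j z α : ℝ≥0∞) ^ 2 + B := by
  have hE2 := sys.expect_arrivalLaw_workload_sq_lt_top ha q l j z
  rw [← sys.expect_arrivalLaw_workload a q l j z] at hlt
  set β := expect (sys.arrivalLaw a q) (fun b => (sys.workload l j z b : ℝ≥0∞))
  set E₂ := expect (sys.arrivalLaw a q) (fun b => (sys.workload l j z b : ℝ≥0∞) ^ 2)
  obtain ⟨ε, hε⟩ := exists_add_of_le hlt.le
  have hβ : β ≠ ⊤ := hlt.ne_top
  have hpt : p z * z.1.1 l j ≠ ⊤ := ENNReal.mul_ne_top (p.apply_ne_top z) (ENNReal.natCast_ne_top _)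
  have hε0 : ε ≠ 0 := by
    rintro rfl
    rw [add_zero] at hε
    exact hlt.ne hε.symm
  have hεt : ε ≠ ⊤ := by
    rintro rfl
    exact hpt (by rw [hε]; simp)
  have h2ε0 : 2 * ε ≠ 0 := mul_ne_zero two_ne_zero hε0
  have h2εt : 2 * ε ≠ ⊤ := ENNReal.mul_ne_top (by simp) hεt
  refine ⟨(2 * ε)⁻¹,
    (2 * ε)⁻¹ * (E₂ + (sys.K ^ 2 + 2 * (sys.K ^ 2 * sys.services l j z) : ℕ)),
    ENNReal.inv_ne_top.2 h2ε0, ENNReal.mul_ne_top (ENNReal.inv_ne_top.2 h2ε0)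
      (ENNReal.add_ne_top.2 ⟨hE2.ne, ENNReal.natCast_ne_top _⟩), fun r α => ?_⟩
  have h := sys.expect_workload_sq_le a p q r l j z α
  set V : ℝ≥0∞ := (sys.workload l j z α : ℝ≥0∞)
  have hV : V ≠ ⊤ := ENNReal.natCast_ne_top _
  rw [expect_const_mul]
  set X := expect (sys.chain a p q r α) fun y => (sys.workload l j z y : ℝ≥0∞) ^ 2
  set B : ℝ≥0∞ := E₂ + (sys.K ^ 2 + 2 * (sys.K ^ 2 * sys.services l j z) : ℕ)
  -- The finite arrival term is kept on both sides and cancelled, since subtraction in `ℝ≥0∞`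
  -- truncates.
  have h' : X + 2 * ε * V + 2 * V * β ≤ V ^ 2 + B + 2 * V * β := by
    calc X + 2 * ε * V + 2 * V * β = X + 2 * V * (β + ε) := by ring
      _ ≤ V ^ 2 + 2 * V * β + B := by rw [← hε]; exact h
      _ = _ := by ring
  have h'' := (ENNReal.add_le_add_iff_right
    (ENNReal.mul_ne_top (ENNReal.mul_ne_top (by simp) hV) hβ)).1 h'
  calc (2 * ε)⁻¹ * X + V = (2 * ε)⁻¹ * (X + 2 * ε * V) := by
        rw [mul_add, ← mul_assoc, ENNReal.inv_mul_cancel h2ε0 h2εt, one_mul]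
    _ ≤ (2 * ε)⁻¹ * (V ^ 2 + B) := by gcongr
    _ = _ := mul_add _ _ _

/-- The system is stable if every subclass is offered more service than it needs. -/
theorem stable_of_lt {a : Fin L → Fin J → PMF ℕ}
    (ha : ∀ l j, expect (a l j) (fun k => (k : ℝ≥0∞) ^ 2) < ⊤) {p : PMF sys.Schedule}
    {q : sys.Classification}
    (hlt : ∀ l j (z : {s : sys.Schedule // 0 < s.1 l j}),
      expect (a l j) (fun k => (k : ℝ≥0∞)) * (q l j z * sys.services l j z) < p z * z.1.1 l j)
    (r : sys.SelectionRule) :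
    PositiveRecurrent (sys.chain a p q r) ∧ (∃ π, IsStationary (sys.chain a p q r) π) ∧
      ∀ π, IsStationary (sys.chain a p q r) π →
        expect π (fun α => (α.length : ℝ≥0∞)) < ⊤ := by
  choose c B hc hB hd using fun l j z => sys.workload_drift ha (hlt l j z)
  have hBt : ∑ l, ∑ j, ∑ z : {s : sys.Schedule // 0 < s.1 l j}, B l j z ≠ ⊤ := by
    simp [ENNReal.sum_eq_top, hB]
  refine stable_of_drift (f := fun α => ∑ l, ∑ j, ∑ z : {s : sys.Schedule // 0 < s.1 l j},
    c l j z * (sys.workload l j z α : ℝ≥0∞) ^ 2) hBt (fun α => ?_) (fun α => ?_) ?_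
  · simp [ENNReal.sum_eq_top, ENNReal.mul_eq_top, hc]
  · simp only [expect_finset_sum]
    calc _ ≤ (∑ l, ∑ j, ∑ z : {s : sys.Schedule // 0 < s.1 l j},
            expect (sys.chain a p q r α) fun y =>
              c l j z * (sys.workload l j z y : ℝ≥0∞) ^ 2)
          + ∑ l, ∑ j, ∑ z : {s : sys.Schedule // 0 < s.1 l j},
            (sys.workload l j z α : ℝ≥0∞) := by
          gcongr
          exact_mod_cast sys.length_le_sum_workload α
      _ ≤ _ := by
          simp only [← Finset.sum_add_distrib]
          exact Finset.sum_le_sum fun l _ => Finset.sum_le_sum fun j _ =>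
            Finset.sum_le_sum fun z _ => hd l j z r α
  · obtain ⟨n, hn⟩ := ENNReal.exists_nat_gt (ENNReal.add_ne_top.2 ⟨hBt, ENNReal.one_ne_top⟩)
    refine (List.finite_length_le sys.Message n).subset fun α hα => ?_
    exact_mod_cast (le_trans hα hn.le : (α.length : ℝ≥0∞) ≤ n)

/-! ### Choice of the policy -/

/-- The quantum cancels: ψ counts message completions, each using `services` transmissions under
complete schedules. -/
theorem psi_eq (p : PMF sys.Schedule) (l : Fin L) (j : Fin J) :
    sys.psi p l j = ∑ s with 0 < s.1 l j, (p s).toReal * (s.1 l j / sys.services l j s) := by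
  unfold psi
  refine Finset.sum_congr rfl fun s hs => ?_
  have hs' : 0 < s.1 l j := by simpa using hs
  rw [sys.ceilMul_S hs', mul_div_mul_right _ _ (sys.quantum_pos hs').ne']

/-- Taking q(z) proportional to p(z) z_lj / N_lj(z), with normalising sum ψ_lj(p), loads every
subclass by the same fraction m_lj / ψ_lj(p) < 1 of its service. Full support keeps p(z) z_lj
positive, hence the inequality strict, for each z. -/
theorem exists_classification {m : Fin L → Fin J → ℝ} {p : PMF sys.Schedule}
    (hp : ∀ s, p s ≠ 0) (hm : ∀ l j, m l j < sys.psi p l j) :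
    ∃ q : sys.Classification, ∀ l j (z : {s : sys.Schedule // 0 < s.1 l j}),
      ENNReal.ofReal (m l j) * (q l j z * sys.services l j z) < p z * z.1.1 l j := by
  suffices h : ∀ l j, ∃ q : PMF {s : sys.Schedule // 0 < s.1 l j}, ∀ z,
      ENNReal.ofReal (m l j) * (q z * sys.services l j z) < p z * z.1.1 l j by
    choose q hq using h
    exact ⟨q, hq⟩
  intro l j
  let v : {s : sys.Schedule // 0 < s.1 l j} → ℝ≥0∞ := fun z =>
    p z * (z.1.1 l j / sys.services l j z)
  have hN0 : ∀ z : {s : sys.Schedule // 0 < s.1 l j}, (sys.services l j z : ℝ≥0∞) ≠ 0 :=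
    fun z => by exact_mod_cast (sys.services_pos z.2).ne'
  have hvt : ∀ z, v z ≠ ⊤ := fun z => ENNReal.mul_ne_top (p.apply_ne_top _)
    (ENNReal.div_ne_top (ENNReal.natCast_ne_top _) (hN0 z))
  have hsumt : ∑' z, v z ≠ ⊤ := by
    simp [tsum_fintype, ENNReal.sum_eq_top, hvt]
  have hpsi : (∑' z, v z).toReal = sys.psi p l j := by
    rw [tsum_fintype, ENNReal.toReal_sum fun z _ => hvt z, sys.psi_eq,
      Finset.sum_subtype (p := fun s : sys.Schedule => 0 < s.1 l j) _ (by simp)]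
    refine Finset.sum_congr rfl fun z _ => ?_
    simp [v, ENNReal.toReal_mul, ENNReal.toReal_div]
  -- A single transmission of class `(l, j)` is a schedule because K ≥ 1; the normalising sum is
  -- therefore nonzero.
  have hne : Nonempty (Σ' s : sys.Schedule, PLift (0 < s.1 l j)) := by
    classical
    refine ⟨⟨⟨Pi.single l (Pi.single j 1), ?_⟩, ⟨by simp⟩⟩⟩
    rw [Finset.sum_eq_single l]
    · simpa [Finset.sum_pi_single'] using sys.one_le_K
    · intro l' _ hl'
      simp [hl']
    · simp
  obtain ⟨s₀, ⟨hs₀⟩⟩ := hne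
  have hv0 : ∀ z, v z ≠ 0 := fun z => mul_ne_zero (hp _) (ENNReal.div_ne_zero.2
    ⟨by exact_mod_cast z.2.ne', ENNReal.natCast_ne_top _⟩)
  have hsum0 : ∑' z, v z ≠ 0 := fun h => hv0 ⟨s₀, hs₀⟩ (ENNReal.tsum_eq_zero.1 h _)
  have hlt : ENNReal.ofReal (m l j) < ∑' z, v z := by
    rw [← ENNReal.ofReal_toReal hsumt, hpsi]
    exact (ENNReal.ofReal_lt_ofReal_iff (hpsi ▸ ENNReal.toReal_pos hsum0 hsumt)).2 (hm l j)
  refine ⟨PMF.normalize v hsum0 hsumt, fun z => ?_⟩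
  rw [PMF.normalize_apply]
  have hvN : v z * sys.services l j z = p z * z.1.1 l j := by
    simp only [v]
    rw [mul_assoc, ENNReal.div_mul_cancel (hN0 z) (ENNReal.natCast_ne_top _)]
  have hR0 : p z * z.1.1 l j ≠ 0 := mul_ne_zero (hp _) (by exact_mod_cast z.2.ne')
  have hRt : p z * z.1.1 l j ≠ ⊤ := ENNReal.mul_ne_top (p.apply_ne_top _) (ENNReal.natCast_ne_top _)
  calc ENNReal.ofReal (m l j) * (v z * (∑' z, v z)⁻¹ * sys.services l j z)
      = (ENNReal.ofReal (m l j) / ∑' z, v z) * (v z * sys.services l j z) := by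
        rw [div_eq_mul_inv]; ring
    _ = (ENNReal.ofReal (m l j) / ∑' z, v z) * (p z * z.1.1 l j) := by rw [hvN]
    _ < 1 * (p z * z.1.1 l j) := by
        refine (ENNReal.mul_lt_mul_iff_left hR0 hRt).2 ?_
        exact (ENNReal.div_lt_iff (Or.inl hsum0) (Or.inl hsumt)).2 (by rwa [one_mul])
    _ = _ := one_mul _

/-- Schedules with full support give, up to an arbitrarily small loss, the same service rates. -/
theorem exists_full_support (p : PMF sys.Schedule) {θ : ℝ} (h0 : 0 < θ) (h1 : θ < 1) :
    ∃ p' : PMF sys.Schedule, (∀ s, p' s ≠ 0) ∧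
      ∀ l j, (1 - θ) * sys.psi p l j ≤ sys.psi p' l j := by
  have hne : Nonempty sys.Schedule := ⟨⟨fun _ _ => 0, by simp⟩⟩
  let u := PMF.uniformOfFintype sys.Schedule
  let w : sys.Schedule → ℝ≥0∞ := fun s => ENNReal.ofReal (1 - θ) * p s + ENNReal.ofReal θ * u s
  have hw : ∑ s, w s = 1 := by
    have h2 : ∑ s, p s = 1 := by rw [← tsum_fintype (L := .unconditional _)]; exact p.tsum_coe
    have h3 : ∑ s, u s = 1 := by rw [← tsum_fintype (L := .unconditional _)]; exact u.tsum_coe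
    simp only [w, Finset.sum_add_distrib, ← Finset.mul_sum, h2, h3, mul_one]
    rw [← ENNReal.ofReal_add (by linarith) h0.le]
    simp
  refine ⟨PMF.ofFintype w hw, fun s => ?_, fun l j => ?_⟩
  · simp only [PMF.ofFintype_apply, w]
    refine (lt_of_lt_of_le ?_ le_add_self).ne'
    have hu : u s ≠ 0 := by
      rw [← PMF.mem_support_iff]
      exact PMF.mem_support_uniformOfFintype s
    exact ENNReal.mul_pos (by simpa using h0) hu
  · rw [sys.psi_eq, sys.psi_eq, Finset.mul_sum]
    refine Finset.sum_le_sum fun s _ => ?_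
    rw [← mul_assoc]
    refine mul_le_mul_of_nonneg_right ?_ (by positivity)
    simp only [PMF.ofFintype_apply, w]
    rw [ENNReal.toReal_add (ENNReal.mul_ne_top ENNReal.ofReal_ne_top (p.apply_ne_top s))
      (ENNReal.mul_ne_top ENNReal.ofReal_ne_top (u.apply_ne_top s)), ENNReal.toReal_mul,
      ENNReal.toReal_ofReal (by linarith)]
    exact le_add_of_nonneg_right ENNReal.toReal_nonneg

theorem exists_policy {m : Fin L → Fin J → ℝ} (hm : ∀ l j, 0 ≤ m l j)
    (hin : sys.Rin ∈ 𝓝[{β | ∀ l j, 0 ≤ β l j}] m) :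
    ∃ p : PMF sys.Schedule, (∀ s, p s ≠ 0) ∧ ∀ l j, m l j < sys.psi p l j := by
  obtain ⟨δ, hδ, p, hp⟩ : ∃ δ > 0, ∃ p : PMF sys.Schedule,
      ∀ l j, m l j + δ ≤ sys.psi p l j := by
    -- Raising all coordinates by a small δ > 0 stays in the orthant and tends to `m`, hence
    -- eventually stays in the region.
    have htend : Filter.Tendsto (fun (δ : ℝ) l j => m l j + δ) (𝓝[>] 0)
        (𝓝[{β | ∀ l j, 0 ≤ β l j}] m) := by
      refine tendsto_nhdsWithin_iff.2 ⟨?_, ?_⟩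
      · have : Continuous fun (δ : ℝ) (l : Fin L) (j : Fin J) => m l j + δ := by fun_prop
        simpa using (this.tendsto 0).mono_left nhdsWithin_le_nhds
      · filter_upwards [self_mem_nhdsWithin] with δ hδ l j
        exact add_nonneg (hm l j) (le_of_lt hδ)
    obtain ⟨δ, hδ, hpos⟩ := ((htend.eventually hin).and self_mem_nhdsWithin).exists
    obtain ⟨p, hp⟩ := Set.mem_iUnion.1 hδ
    exact ⟨δ, hpos, p, fun l j => (hp l j).2⟩
  have hT : 0 ≤ ∑ l, ∑ j, m l j := Finset.sum_nonneg fun l _ => Finset.sum_nonneg fun j _ => hm l j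
  set T := ∑ l, ∑ j, m l j with hTdef
  have hD : 0 < 2 * (T + δ) := by linarith
  -- As m_lj ≤ T for every class, this θ gives θ(m_lj + δ) ≤ δ/2, so mixing uses up at most half of
  -- the slack δ.
  obtain ⟨p', hp', hle⟩ := sys.exists_full_support p (θ := δ / (2 * (T + δ)))
    (div_pos hδ hD) (by rw [div_lt_one hD]; linarith)
  refine ⟨p', hp', fun l j => ?_⟩
  have hmT : m l j ≤ T :=
    (Finset.single_le_sum (f := fun j => m l j) (fun j _ => hm l j) (Finset.mem_univ j)).trans
      (Finset.single_le_sum (f := fun l => ∑ j, m l j)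
        (fun l _ => Finset.sum_nonneg fun j _ => hm l j) (Finset.mem_univ l))
  have hθ : δ / (2 * (T + δ)) * (m l j + δ) ≤ δ / 2 := by
    rw [div_mul_eq_mul_div, div_le_div_iff₀ hD two_pos]
    nlinarith
  have hθ1 : 0 ≤ 1 - δ / (2 * (T + δ)) := by
    rw [sub_nonneg, div_le_one hD]; linarith
  calc m l j < (1 - δ / (2 * (T + δ))) * (m l j + δ) := by linarith
    _ ≤ (1 - δ / (2 * (T + δ))) * sys.psi p l j := mul_le_mul_of_nonneg_left (hp l j) hθ1
    _ ≤ _ := hle l j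

end System

/-! ### Arrival moments: from real sums to extended nonnegative expectations -/

theorem expect_sq_lt_top {p : PMF ℕ} (h : Summable fun k : ℕ => (k : ℝ) ^ 2 * (p k).toReal) :
    expect p (fun k => (k : ℝ≥0∞) ^ 2) < ⊤ := by
  have h1 : expect p (fun k => (k : ℝ≥0∞) ^ 2)
      = ∑' k : ℕ, ENNReal.ofReal ((k : ℝ) ^ 2 * (p k).toReal) := by
    refine tsum_congr fun k => ?_
    rw [ENNReal.ofReal_mul (by positivity), ENNReal.ofReal_toReal (p.apply_ne_top k),
      ENNReal.ofReal_pow (by positivity), ENNReal.ofReal_natCast, mul_comm]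
  rw [h1]
  exact h.tsum_ofReal_lt_top

/-- A divergent real `tsum` is 0 by default; k ≤ k² and the second moment exclude this case. -/
theorem expect_eq_ofReal {p : PMF ℕ} (h : Summable fun k : ℕ => (k : ℝ) ^ 2 * (p k).toReal) :
    expect p (fun k => (k : ℝ≥0∞)) = ENNReal.ofReal (∑' k : ℕ, (k : ℝ) * (p k).toReal) := by
  have hs : Summable fun k : ℕ => (k : ℝ) * (p k).toReal := by
    refine Summable.of_nonneg_of_le (fun k => by positivity) (fun k => ?_) h
    refine mul_le_mul_of_nonneg_right ?_ ENNReal.toReal_nonneg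
    exact_mod_cast Nat.le_self_pow two_ne_zero k
  rw [ENNReal.ofReal_tsum_of_nonneg (fun k => by positivity) hs]
  refine tsum_congr fun k => ?_
  rw [ENNReal.ofReal_mul (by positivity), ENNReal.ofReal_toReal (p.apply_ne_top k),
    ENNReal.ofReal_natCast, mul_comm]

end Multiaccess

end

theorem mainTheorem8 {L J : ℕ} (sys : Multiaccess.System L J)
    (a : Fin L → Fin J → PMF ℕ)
    (ha : ∀ l j, Summable fun k : ℕ => (k : ℝ) ^ 2 * (a l j k).toReal)
    (hin : sys.Rin ∈ 𝓝[{β | ∀ l j, 0 ≤ β l j}] (Multiaccess.meanArrivals a)) :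
    ∃ (p : PMF sys.Schedule) (q : sys.Classification), ∀ r : sys.SelectionRule,
      Multiaccess.PositiveRecurrent (sys.chain a p q r) ∧
      (∃ π, Multiaccess.IsStationary (sys.chain a p q r) π) ∧
      ∀ π, Multiaccess.IsStationary (sys.chain a p q r) π →
        ∀ l j, ∑' α, π α * (sys.numClass α l j : ℝ≥0∞) < ⊤ := by
  obtain ⟨p, hp, hlt⟩ := sys.exists_policy
    (fun l j => tsum_nonneg fun k => mul_nonneg (Nat.cast_nonneg k) ENNReal.toReal_nonneg) hin
  obtain ⟨q, hq⟩ := sys.exists_classification hp hlt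
  refine ⟨p, q, fun r => ?_⟩
  obtain ⟨h1, h2, h3⟩ := sys.stable_of_lt (fun l j => Multiaccess.expect_sq_lt_top (ha l j))
    (fun l j z => by rw [Multiaccess.expect_eq_ofReal (ha l j)]; exact hq l j z) r
  refine ⟨h1, h2, fun π hπ l j => lt_of_le_of_lt (Multiaccess.expect_mono π fun α => ?_) (h3 π hπ)⟩
  exact_mod_cast List.countP_le_length
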